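/- For $(s,t,u)\in\mathbb C^3$ with $\Re(s+u)>1$, $\Re(t+u)>1$ and $\Re(s+t+u)>2$ let $$T(s,t,u)=\sum_{m,n=1}^{\infty}\frac{1}{m^s n^t (m+n)^u}$$ (absolutely convergent). Put $$\Omega'=\{(s,t,u)\in\mathbb C^3 : t+u\notin\mathbb Z_{\le 1},\ u+s\notin\mathbb Z_{\le 1}\},\qquad \Omega=\{(s,t,u)\in\Omega' : s+t+u\ne 2\}.$$ The function $T$ has a holomorphic continuation to $\Omega$, again denoted by $T$. On the set $\Omega_0$ of all $(s,t,u)$ such that $(s,t,u)$, $(u,s,t)$ and $(t,u,s)$ lie in $\Omega$, put $$\begin{aligned} S_1(s,t,u)&=(1+e^{-\pi i(s+t+u)})T(s,t,u)+(e^{-\pi is}+e^{-\pi i(u+t)})T(u,s,t)+(e^{-\pi it}+e^{-\pi i(u+s)})T(t,u,s),\\ S_2(s,t,u)&=(e^{-\pi iu}+e^{-\pi i(s+t)})T(s,t,u)+(e^{-\pi it}+e^{-\pi i(u+s)})T(u,s,t)+(e^{-\pi is}+e^{-\pi i(t+u)})T(t,u,s),\\ S_3(s,t,u)&=T(s,t,u)+T(u,s,t)+T(t,u,s),\\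 S_4(s,t,u)&=-T(s,t,u)+T(u,s,t)+T(t,u,s). \end{aligned}$$ Then identity (i) below holds on $\Omega'$ and identities (ii)–(viii) hold on $\Omega$, in the following sense: both sides (the left one given by its formula where $T(s,t,u)$ is defined, i.e. on $\Omega$, the right one on $\Omega_0$) extend to holomorphic functions on the whole of $\Omega'$, respectively $\Omega$, and these extensions are equal. In particular the two sides are equal at every point of $\Omega_0$. $$\begin{aligned} \text{(i)}\quad &(1-e^{-2\pi is})(1-e^{-2\pi it})(e^{-\pi i(s+t+u)}-1)T(s,t,u)\\ &\quad=(e^{-2\pi i(s+t)}-1)S_1(s,t,u)+e^{-\pi is}(1-e^{-2\pi it})S_1(u,s,t)+e^{-\pi it}(1-e^{-2\pi is})S_1(t,u,s),\\ \text{(ii)}\quad &(1-e^{-2\pi is})(1-e^{-2\pi it})(e^{-\pi i(s+t)}-e^{-\pi iu})T(s,t,u)\\ &\quad=(e^{-2\pi i(s+t)}-1)S_2(s,t,u)+e^{-\pi it}(1-e^{-2\pi is})S_1(u,s,t)+e^{-\pi is}(1-e^{-2\pi it})S_1(t,u,s),\\ \text{(iii)}\quad &2T(s,t,u)=S_3(s,t,u)-S_4(s,t,u),\\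 \text{(iv)}\quad &(1-e^{-\pi is})(1-e^{-\pi it})(1+e^{-\pi iu})T(s,t,u)\\ &\quad=(1+e^{-\pi iu})(1+e^{-\pi i(s+t)})S_3(s,t,u)-S_1(u,s,t)-S_1(t,u,s),\\ \text{(v)}\quad &(1+e^{-\pi is})(1+e^{-\pi it})(1+e^{-\pi iu})T(s,t,u)\\ &\quad=-(1+e^{-\pi iu})(1+e^{-\pi i(s+t)})S_4(s,t,u)+S_1(u,s,t)+S_1(t,u,s),\\ \text{(vi)}\quad &(1-e^{-\pi is})(1-e^{-\pi it})(1+e^{-\pi iu})T(s,t,u)\\ &\quad=S_1(s,t,u)+S_2(s,t,u)-(e^{-\pi is}+e^{-\pi it})(1+e^{-\pi iu})S_3(s,t,u),\\ \text{(vii)}\quad &(1+e^{-\pi is})(1+e^{-\pi it})(1+e^{-\pi iu})T(s,t,u)\\ &\quad=S_1(s,t,u)+S_2(s,t,u)-(e^{-\pi is}+e^{-\pi it})(1+e^{-\pi iu})S_4(s,t,u),\\ \text{(viii)}\quad &2T(s,t,u)=S_4(u,s,t)+S_4(t,u,s). \end{aligned}$$ -/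

import Mathlib

noncomputable section

namespace TornheimZeta

/-- The set of integers that are at most `1`, inside `ℂ`. -/
def intsLeOne : Set ℂ := {z | ∃ n : ℤ, n ≤ 1 ∧ z = (n : ℂ)}

/-- The region `Re (s+u) > 1`, `Re (t+u) > 1`, `Re (s+t+u) > 2` of absolute convergence. -/
def convergenceRegion : Set (ℂ × ℂ × ℂ) :=
  {p | 1 < (p.1 + p.2.2).re ∧ 1 < (p.2.1 + p.2.2).re ∧ 2 < (p.1 + p.2.1 + p.2.2).re}

/-- The complement of the hyperplanes `t+u ∈ ℤ_{≤1}` and `u+s ∈ ℤ_{≤1}`. -/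
def partlyRegularSet : Set (ℂ × ℂ × ℂ) :=
  {p | p.2.1 + p.2.2 ∉ intsLeOne ∧ p.2.2 + p.1 ∉ intsLeOne}

/-- The complement of the hyperplanes `t+u ∈ ℤ_{≤1}`, `u+s ∈ ℤ_{≤1}`, `s+t+u = 2`: the domain to
which the double series is continued. -/
def regularSet : Set (ℂ × ℂ × ℂ) :=
  {p | p.2.1 + p.2.2 ∉ intsLeOne ∧ p.2.2 + p.1 ∉ intsLeOne ∧ p.1 + p.2.1 + p.2.2 ≠ 2}

/-- The (dense open) set of `(s,t,u)` for which `(s,t,u)`, `(u,s,t)` and `(t,u,s)` are all in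
`regularSet`. -/
def genericSet : Set (ℂ × ℂ × ℂ) :=
  {p | p ∈ regularSet ∧ (p.2.2, p.1, p.2.1) ∈ regularSet ∧ (p.2.1, p.2.2, p.1) ∈ regularSet}

/-- The term `1 / (m^s n^t (m+n)^u)` with `m = k.1 + 1 ≥ 1` and `n = k.2 + 1 ≥ 1`. -/
def tornheimTerm (s t u : ℂ) (k : ℕ × ℕ) : ℂ :=
  1 / (((k.1 + 1 : ℕ) : ℂ) ^ s * ((k.2 + 1 : ℕ) : ℂ) ^ t *
    (((k.1 + 1) + (k.2 + 1) : ℕ) : ℂ) ^ u)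

/-- A function of three complex variables is holomorphic on the (open) set `Ω`. -/
def HolomorphicOn (F : ℂ → ℂ → ℂ → ℂ) (Ω : Set (ℂ × ℂ × ℂ)) : Prop :=
  DifferentiableOn ℂ (fun p : ℂ × ℂ × ℂ => F p.1 p.2.1 p.2.2) Ω

/-- `F` is the analytic continuation of the Tornheim double series: it is holomorphic on the
connected open set `regularSet` and is the sum of the (absolutely convergent) double series in
the region of convergence. -/
def IsTornheimContinuation (F : ℂ → ℂ → ℂ → ℂ) : Prop :=
  HolomorphicOn F regularSet ∧
    ∀ s t u : ℂ, (s, t, u) ∈ convergenceRegion → HasSum (tornheimTerm s t u) (F s t u)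

open scoped Classical in
/-- The Tornheim double zeta function: the analytic continuation of the double series to
`regularSet`, and the value `0` by convention outside of `regularSet`. -/
def T (s t u : ℂ) : ℂ :=
  if (s, t, u) ∈ regularSet then Classical.epsilon IsTornheimContinuation s t u else 0

/-- `ex z = e^{-π i z}`. -/
def ex (z : ℂ) : ℂ := Complex.exp (-((Real.pi : ℂ) * Complex.I * z))

/-- The first symmetric Tornheim double zeta function. -/
def S₁ (s t u : ℂ) : ℂ :=
  (1 + ex (s + t + u)) * T s t u + (ex s + ex (u + t)) * T u s t + (ex t + ex (u + s)) * T t u s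

/-- The second symmetric Tornheim double zeta function. -/
def S₂ (s t u : ℂ) : ℂ :=
  (ex u + ex (s + t)) * T s t u + (ex t + ex (u + s)) * T u s t + (ex s + ex (t + u)) * T t u s

/-- The third symmetric Tornheim double zeta function. -/
def S₃ (s t u : ℂ) : ℂ := T s t u + T u s t + T t u s

/-- The fourth symmetric Tornheim double zeta function. -/
def S₄ (s t u : ℂ) : ℂ := -T s t u + T u s t + T t u s

/-- The identity `L = R` outside the singularities, on `Ω`. Here `L` involves only `T s t u`, and
`R` only `T s t u`, `T u s t`, `T t u s`, so that `L` is given by its formula on `regularSet` and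
`R` on `genericSet`. The predicate says that both sides continue holomorphically to all of `Ω`
(removable singularities being removed) and that their continuations coincide on `Ω`. -/
def HolomorphicIdentityOn (Ω : Set (ℂ × ℂ × ℂ)) (L R : ℂ → ℂ → ℂ → ℂ) : Prop :=
  ∃ H : ℂ → ℂ → ℂ → ℂ, HolomorphicOn H Ω ∧
    (∀ s t u : ℂ, (s, t, u) ∈ Ω → (s, t, u) ∈ regularSet → L s t u = H s t u) ∧
    (∀ s t u : ℂ, (s, t, u) ∈ Ω → (s, t, u) ∈ genericSet → R s t u = H s t u)

end TornheimZeta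

end

open TornheimZeta

/-! The eight identities are formal. Cyclic shifts of `S₁`, …, `S₄` involve only the three values `T
s t u`, `T u s t`, `T t u s`, so once `ex` is expanded multiplicatively each right side collapses to
the stated coefficient times `T s t u`. The analytic content is that `T` continues to `regularSet`,
and that its only singularity along `s + t + u = 2` is at most a simple pole. In (i) that pole is
cancelled by the zero of `ex z - 1` at `z = 2`.

The series is a double integral `J` of the kernel `x^{-s} y^{-t} (x+y)^{-u}` against two counting
measures. Euler–Maclaurin in each variable replaces a counting measure by Lebesgue measure on `(1,
∞)` weighted by `B_0` or `B_1({x})`, and a point mass at `1`. Every resulting `J` satisfies an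
affine recurrence obtained by integration by parts. Where all translations push `s+u`, `t+u` and
`s+t+u` up by at least one, iterating the recurrence continues `J` (`Continues.of_recurrence`). Its
only denominators are positive integers and `t + u - 1`, whose translates give the excluded
hyperplanes (those in `u + s` come by symmetry).

The one exception is Lebesgue measure in both variables. There the recurrences in `x` and `y` add up
to a closed formula with the factor `s + t + u - 2` (`J_bern_zero_bern_zero`), the source of the
pole. Uniqueness (`eqOn_regularSet`) identifies `T`, chosen abstractly, with this continuation. -/

noncomputable section
open MeasureTheory Set Filter Topology

namespace TornheimZeta

/-! ### Domination of the kernel by products of powers. -/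

/-- The function `x^{-s} y^{-t} (x+y)^{-u}` of two positive real variables. -/
def kern (p : ℂ × ℂ × ℂ) (x y : ℝ) : ℂ :=
  (x : ℂ) ^ (-p.1) * (y : ℂ) ^ (-p.2.1) * ((x + y : ℝ) : ℂ) ^ (-p.2.2)

/-- The function `x^{-σ} y^{-τ} (x+y)^{-υ}` with real exponents. -/
def realKern (σ τ υ x y : ℝ) : ℝ := x ^ (-σ) * y ^ (-τ) * (x + y) ^ (-υ)

lemma norm_kern (p : ℂ × ℂ × ℂ) {x y : ℝ} (hx : 1 ≤ x) (hy : 1 ≤ y) :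
    ‖kern p x y‖ = realKern p.1.re p.2.1.re p.2.2.re x y := by
  have h1 : 0 < x := by linarith
  have h2 : 0 < y := by linarith
  have h3 : 0 < x + y := by linarith
  rw [kern, realKern, norm_mul, norm_mul, Complex.norm_cpow_eq_rpow_re_of_pos h1,
    Complex.norm_cpow_eq_rpow_re_of_pos h2, Complex.norm_cpow_eq_rpow_re_of_pos h3]
  simp

lemma realKern_comm (σ τ υ x y : ℝ) : realKern σ τ υ x y = realKern τ σ υ y x := by
  simp only [realKern, add_comm x y]; ring

lemma realKern_nonneg (σ τ υ : ℝ) {x y : ℝ} (hx : 1 ≤ x) (hy : 1 ≤ y) :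
    0 ≤ realKern σ τ υ x y := by
  unfold realKern; positivity

/-- The ratio `(x + y) / y` lies in `[1, 2]`, so replacing `x + y` by `y` costs at most `2 ^ |υ|`,
whatever the sign of `υ`. -/
lemma rpow_neg_add_le (υ : ℝ) {x y : ℝ} (hx : 1 ≤ x) (hxy : x ≤ y) :
    (x + y) ^ (-υ) ≤ 2 ^ |υ| * y ^ (-υ) := by
  have hy : 0 < y := by linarith
  have hr : x + y = ((x + y) / y) * y := by field_simp
  have h1 : 1 ≤ (x + y) / y := by rw [le_div_iff₀ hy]; linarith
  have h2 : (x + y) / y ≤ 2 := by rw [div_le_iff₀ hy]; linarith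
  calc (x + y) ^ (-υ) = ((x + y) / y) ^ (-υ) * y ^ (-υ) := by
        conv_lhs => rw [hr]
        exact Real.mul_rpow (by linarith) hy.le
    _ ≤ 2 ^ |υ| * y ^ (-υ) := by
        gcongr
        calc ((x + y) / y) ^ (-υ) ≤ ((x + y) / y) ^ |υ| :=
              Real.rpow_le_rpow_of_exponent_le h1 (neg_le_abs υ)
          _ ≤ 2 ^ |υ| := Real.rpow_le_rpow (by linarith) h2 (abs_nonneg _)

/-- For `x ≤ y` the factor `(x+y)^{-υ}` behaves like `y^{-υ}`, and `x^δ ≤ y^δ` allows surplus decay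
in `y` to be handed over to `x`. -/
lemma exists_realKern_le_of_le {σ τ υ : ℝ} (h2 : 1 < τ + υ) (h3 : 2 < σ + τ + υ) :
    ∃ a b : ℝ, 1 < a ∧ 1 < b ∧ ∀ x y : ℝ, 1 ≤ x → x ≤ y →
      realKern σ τ υ x y ≤ 2 ^ |υ| * (x ^ (-a) * y ^ (-b)) := by
  -- The amount `δ` moved must leave both exponents `σ + δ` and `τ + υ - δ` above `1`; the two
  -- hypotheses say exactly that such a positive `δ` exists.
  obtain ⟨δ, hδ1, hδ2⟩ : ∃ δ, max 0 (1 - σ) < δ ∧ δ < τ + υ - 1 :=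
    exists_between (max_lt (by linarith) (by linarith))
  have hδ0 : 0 < δ := lt_of_le_of_lt (le_max_left _ _) hδ1
  have hδσ : 1 - σ < δ := lt_of_le_of_lt (le_max_right _ _) hδ1
  refine ⟨σ + δ, τ + υ - δ, by linarith, by linarith, fun x y hx hxy => ?_⟩
  have hx0 : 0 < x := by linarith
  have hy0 : 0 < y := by linarith
  calc realKern σ τ υ x y ≤ x ^ (-σ) * y ^ (-τ) * (2 ^ |υ| * y ^ (-υ)) := by
        unfold realKern
        gcongr
        exact rpow_neg_add_le υ hx hxy
    _ = 2 ^ |υ| * (x ^ (-(σ + δ)) * y ^ (-(τ + υ))) * x ^ δ := by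
        rw [show -(σ + δ) = -σ - δ by ring, Real.rpow_sub hx0, show -(τ + υ) = -τ + -υ by ring,
          Real.rpow_add hy0]
        field_simp
    _ ≤ 2 ^ |υ| * (x ^ (-(σ + δ)) * y ^ (-(τ + υ))) * y ^ δ := by gcongr
    _ = 2 ^ |υ| * (x ^ (-(σ + δ)) * y ^ (-(τ + υ - δ))) := by
        rw [show -(τ + υ - δ) = -(τ + υ) + δ by ring, Real.rpow_add hy0]
        ring

/-- In the region of convergence the kernel is dominated by products of integrable powers. -/
lemma exists_realKern_le {σ τ υ : ℝ} (h1 : 1 < σ + υ) (h2 : 1 < τ + υ) (h3 : 2 < σ + τ + υ) :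
    ∃ C a b a' b' : ℝ, 1 < a ∧ 1 < b ∧ 1 < a' ∧ 1 < b' ∧ ∀ x y : ℝ, 1 ≤ x → 1 ≤ y →
      realKern σ τ υ x y ≤ C * (x ^ (-a) * y ^ (-b) + x ^ (-a') * y ^ (-b')) := by
  obtain ⟨a, b, ha, hb, hab⟩ := exists_realKern_le_of_le h2 h3
  obtain ⟨b', a', hb', ha', hab'⟩ := exists_realKern_le_of_le (σ := τ) h1 (by linarith)
  refine ⟨2 ^ |υ|, a, b, a', b', ha, hb, ha', hb', fun x y hx hy => ?_⟩
  rw [mul_add]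
  rcases le_total x y with h | h
  · refine (hab x y hx h).trans (le_add_of_nonneg_right (by positivity))
  · rw [realKern_comm]
    refine (hab' y x hy h).trans ?_
    rw [mul_comm (y ^ _)]
    exact le_add_of_nonneg_left (by positivity)

/-! ### Double integrals against weighted measures, and their holomorphy. -/

/-- A measure on `[1, ∞)` of at most linear growth, together with a bounded weight. -/
structure Weight where
  /-- the measure -/
  μ : Measure ℝ
  /-- the weight -/
  w : ℝ → ℂ
  sfinite : SFinite μ
  one_le : ∀ᵐ x ∂μ, 1 ≤ x
  integrable_rpow : ∀ a : ℝ, 1 < a → Integrable (fun x : ℝ => x ^ (-a)) μ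
  measurable_w : Measurable w
  bounded_w : ∃ C : ℝ, ∀ x, ‖w x‖ ≤ C

attribute [instance] Weight.sfinite

namespace Weight

variable (a b : Weight)

lemma one_le_prod : ∀ᵐ z ∂(a.μ.prod b.μ), 1 ≤ z.1 ∧ 1 ≤ z.2 :=
  (Measure.quasiMeasurePreserving_fst.ae a.one_le).and
    (Measure.quasiMeasurePreserving_snd.ae b.one_le)

lemma integrable_realKern {σ τ υ : ℝ} (h1 : 1 < σ + υ) (h2 : 1 < τ + υ) (h3 : 2 < σ + τ + υ) :
    Integrable (fun z : ℝ × ℝ => realKern σ τ υ z.1 z.2) (a.μ.prod b.μ) := by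
  obtain ⟨C, e, f, e', f', he, hf, he', hf', h⟩ := exists_realKern_le h1 h2 h3
  have hi := (((a.integrable_rpow e he).mul_prod (b.integrable_rpow f hf)).add
    ((a.integrable_rpow e' he').mul_prod (b.integrable_rpow f' hf'))).const_mul C
  refine hi.mono' ?_ ?_
  · unfold realKern
    exact Measurable.aestronglyMeasurable (by fun_prop)
  · filter_upwards [a.one_le_prod b] with z hz
    rw [Real.norm_of_nonneg (realKern_nonneg _ _ _ hz.1 hz.2)]
    exact h _ _ hz.1 hz.2

/-- The integrand of `J`. -/
def integrand (p : ℂ × ℂ × ℂ) (z : ℝ × ℝ) : ℂ := a.w z.1 * b.w z.2 * kern p z.1 z.2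

lemma measurable_kern (p : ℂ × ℂ × ℂ) : Measurable (fun z : ℝ × ℝ => kern p z.1 z.2) := by
  unfold kern; fun_prop

lemma measurable_integrand (p : ℂ × ℂ × ℂ) : Measurable (a.integrand b p) := by
  have := measurable_kern p
  have h1 := a.measurable_w
  have h2 := b.measurable_w
  unfold integrand
  fun_prop

lemma exists_norm_integrand_le : ∃ C : ℝ, 0 ≤ C ∧ ∀ p : ℂ × ℂ × ℂ, ∀ z : ℝ × ℝ, 1 ≤ z.1 → 1 ≤ z.2 →
    ‖a.integrand b p z‖ ≤ C * realKern p.1.re p.2.1.re p.2.2.re z.1 z.2 := by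
  obtain ⟨A, hA⟩ := a.bounded_w
  obtain ⟨B, hB⟩ := b.bounded_w
  have hA0 : 0 ≤ A := (norm_nonneg _).trans (hA 0)
  have hB0 : 0 ≤ B := (norm_nonneg _).trans (hB 0)
  refine ⟨A * B, by positivity, fun p z h1 h2 => ?_⟩
  rw [integrand, norm_mul, norm_mul, norm_kern p h1 h2]
  have := realKern_nonneg p.1.re p.2.1.re p.2.2.re h1 h2
  gcongr
  · exact hA _
  · exact hB _

lemma integrable_integrand {p : ℂ × ℂ × ℂ} (hp : p ∈ convergenceRegion) :
    Integrable (a.integrand b p) (a.μ.prod b.μ) := by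
  obtain ⟨C, -, hC⟩ := a.exists_norm_integrand_le b
  obtain ⟨h1, h2, h3⟩ := hp
  simp only [Complex.add_re] at h1 h2 h3
  refine ((a.integrable_realKern b h1 h2 h3).const_mul C).mono'
    (a.measurable_integrand b p).aestronglyMeasurable ?_
  filter_upwards [a.one_le_prod b] with z hz using hC p z hz.1 hz.2

/-- The double integral `∫∫ x^{-s} y^{-t} (x+y)^{-u}` against two weights. -/
def J (p : ℂ × ℂ × ℂ) : ℂ := ∫ z, a.integrand b p z ∂(a.μ.prod b.μ)

/-- The derivative of the kernel in the exponents, divided by the kernel. -/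
def kernLogDeriv (x y : ℝ) : ℂ × ℂ × ℂ →L[ℂ] ℂ :=
  -((Real.log x : ℂ) • ContinuousLinearMap.fst ℂ ℂ (ℂ × ℂ)
    + (Real.log y : ℂ) • (ContinuousLinearMap.fst ℂ ℂ ℂ ∘L ContinuousLinearMap.snd ℂ ℂ (ℂ × ℂ))
    + (Real.log (x + y) : ℂ) •
      (ContinuousLinearMap.snd ℂ ℂ ℂ ∘L ContinuousLinearMap.snd ℂ ℂ (ℂ × ℂ)))

/-- For fixed `x, y` the kernel is the exponential of a linear form in the exponents, which makes it
entire in `p` with an explicit derivative. -/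
lemma kern_eq_exp (p : ℂ × ℂ × ℂ) {x y : ℝ} (hx : 1 ≤ x) (hy : 1 ≤ y) :
    kern p x y = Complex.exp (kernLogDeriv x y p) := by
  have h1 : (x : ℂ) ≠ 0 := by norm_cast; linarith
  have h2 : (y : ℂ) ≠ 0 := by norm_cast; linarith
  have h3 : ((x + y : ℝ) : ℂ) ≠ 0 := by norm_cast; linarith
  rw [kern, Complex.cpow_def_of_ne_zero h1, Complex.cpow_def_of_ne_zero h2,
    Complex.cpow_def_of_ne_zero h3, ← Complex.exp_add, ← Complex.exp_add]
  congr 1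
  rw [← Complex.ofReal_log (by linarith), ← Complex.ofReal_log (by linarith),
    ← Complex.ofReal_log (by linarith)]
  simp only [kernLogDeriv, _root_.neg_apply, _root_.add_apply,
    _root_.smul_apply, ContinuousLinearMap.comp_apply,
    ContinuousLinearMap.coe_fst', ContinuousLinearMap.coe_snd', smul_eq_mul]
  ring

lemma hasFDerivAt_kern (p : ℂ × ℂ × ℂ) {x y : ℝ} (hx : 1 ≤ x) (hy : 1 ≤ y) :
    HasFDerivAt (fun q => kern q x y) (kern p x y • kernLogDeriv x y) p := by
  have h : (fun q => kern q x y) = fun q => Complex.exp (kernLogDeriv x y q) := by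
    ext q; exact kern_eq_exp q hx hy
  rw [h, kern_eq_exp p hx hy]
  exact (kernLogDeriv x y).hasFDerivAt.cexp

lemma norm_kernLogDeriv_le {x y : ℝ} (hx : 1 ≤ x) (hy : 1 ≤ y) :
    ‖kernLogDeriv x y‖ ≤ 3 * Real.log (x + y) := by
  have l1 : 0 ≤ Real.log x := Real.log_nonneg hx
  have l2 : 0 ≤ Real.log y := Real.log_nonneg hy
  have l3 : 0 ≤ Real.log (x + y) := Real.log_nonneg (by linarith)
  have m1 : Real.log x ≤ Real.log (x + y) := Real.log_le_log (by linarith) (by linarith)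
  have m2 : Real.log y ≤ Real.log (x + y) := Real.log_le_log (by linarith) (by linarith)
  refine ContinuousLinearMap.opNorm_le_bound _ (by positivity) fun q => ?_
  have n1 : ‖q.1‖ ≤ ‖q‖ := norm_fst_le q
  have n2 : ‖q.2.1‖ ≤ ‖q‖ := (norm_fst_le q.2).trans (norm_snd_le q)
  have n3 : ‖q.2.2‖ ≤ ‖q‖ := (norm_snd_le q.2).trans (norm_snd_le q)
  have e : kernLogDeriv x y q = -(Real.log x * q.1 + Real.log y * q.2.1
      + Real.log (x + y) * q.2.2) := by
    simp [kernLogDeriv]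
  rw [e, norm_neg]
  refine (norm_add₃_le).trans ?_
  rw [norm_mul, norm_mul, norm_mul, Complex.norm_real, Complex.norm_real, Complex.norm_real,
    Real.norm_of_nonneg l1, Real.norm_of_nonneg l2, Real.norm_of_nonneg l3]
  have := mul_le_mul m1 n1 (norm_nonneg _) l3
  have := mul_le_mul m2 n2 (norm_nonneg _) l3
  have := mul_le_mul le_rfl n3 (norm_nonneg _) l3
  linarith

lemma measurable_kernLogDeriv : Measurable (fun z : ℝ × ℝ => kernLogDeriv z.1 z.2) := by
  unfold kernLogDeriv
  refine Measurable.neg (Measurable.add (Measurable.add ?_ ?_) ?_)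
  all_goals exact Measurable.smul_const (by fun_prop) _

lemma realKern_antitone {σ τ υ σ' τ' υ' x y : ℝ} (hσ : σ' ≤ σ) (hτ : τ' ≤ τ) (hυ : υ' ≤ υ)
    (hx : 1 ≤ x) (hy : 1 ≤ y) : realKern σ τ υ x y ≤ realKern σ' τ' υ' x y := by
  have h : 1 ≤ x + y := by linarith
  unfold realKern
  gcongr

/-- `J a b` is holomorphic in the region of absolute convergence. -/
theorem differentiableOn_J : DifferentiableOn ℂ (a.J b) convergenceRegion := by
  intro p hp
  refine DifferentiableAt.differentiableWithinAt ?_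
  obtain ⟨h1, h2, h3⟩ := hp
  simp only [Complex.add_re] at h1 h2 h3
  -- On the ball of radius `ε` each real part drops by at most `ε`, and the logarithm in the
  -- derivative costs one more `ε` in the last exponent. This gives `3 * ε` for the sums of two
  -- exponents and `4 * ε` for the sum of three.
  obtain ⟨ε, hε, hε1, hε2, hε3⟩ : ∃ ε > 0, 1 < p.1.re + p.2.2.re - 3 * ε ∧
      1 < p.2.1.re + p.2.2.re - 3 * ε ∧ 2 < p.1.re + p.2.1.re + p.2.2.re - 4 * ε := by
    refine ⟨min (p.1.re + p.2.2.re - 1) (min (p.2.1.re + p.2.2.re - 1)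
      (p.1.re + p.2.1.re + p.2.2.re - 2)) / 8, ?_, ?_, ?_, ?_⟩
    · have : 0 < min (p.1.re + p.2.2.re - 1) (min (p.2.1.re + p.2.2.re - 1)
        (p.1.re + p.2.1.re + p.2.2.re - 2)) := by
        refine lt_min ?_ (lt_min ?_ ?_) <;> linarith
      linarith
    · have := min_le_left (p.1.re + p.2.2.re - 1) (min (p.2.1.re + p.2.2.re - 1)
        (p.1.re + p.2.1.re + p.2.2.re - 2))
      linarith
    · have := (min_le_right (p.1.re + p.2.2.re - 1) (min (p.2.1.re + p.2.2.re - 1)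
        (p.1.re + p.2.1.re + p.2.2.re - 2))).trans (min_le_left _ _)
      linarith
    · have := (min_le_right (p.1.re + p.2.2.re - 1) (min (p.2.1.re + p.2.2.re - 1)
        (p.1.re + p.2.1.re + p.2.2.re - 2))).trans (min_le_right _ _)
      linarith
  obtain ⟨C, hC0, hC⟩ := a.exists_norm_integrand_le b
  set σ := p.1.re - ε
  set τ := p.2.1.re - ε
  set υ := p.2.2.re - ε
  have hball : ∀ q ∈ Metric.ball p ε, σ ≤ q.1.re ∧ τ ≤ q.2.1.re ∧ υ ≤ q.2.2.re := by
    intro q hq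
    rw [mem_ball_iff_norm] at hq
    have n1 : ‖(q - p).1‖ ≤ ‖q - p‖ := norm_fst_le _
    have n2 : ‖(q - p).2.1‖ ≤ ‖q - p‖ := (norm_fst_le (q - p).2).trans (norm_snd_le _)
    have n3 : ‖(q - p).2.2‖ ≤ ‖q - p‖ := (norm_snd_le (q - p).2).trans (norm_snd_le _)
    have r1 := (abs_le.1 (Complex.abs_re_le_norm (q - p).1)).1
    have r2 := (abs_le.1 (Complex.abs_re_le_norm (q - p).2.1)).1
    have r3 := (abs_le.1 (Complex.abs_re_le_norm (q - p).2.2)).1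
    simp only [Prod.fst_sub, Prod.snd_sub, Complex.sub_re] at r1 r2 r3 n1 n2 n3
    refine ⟨?_, ?_, ?_⟩ <;> simp only [σ, τ, υ] <;> linarith
  have key := hasFDerivAt_integral_of_dominated_of_fderiv_le (μ := a.μ.prod b.μ) (𝕜 := ℂ)
    (F := fun q z => a.integrand b q z) (x₀ := p) (s := Metric.ball p ε)
    (F' := fun q z => a.integrand b q z • kernLogDeriv z.1 z.2)
    (bound := fun z => 3 * C / ε * realKern σ τ (υ - ε) z.1 z.2)
    (Metric.ball_mem_nhds p hε)
    (Eventually.of_forall fun q => (a.measurable_integrand b q).aestronglyMeasurable)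
    (a.integrable_integrand b ⟨by simpa using h1, by simpa using h2, by simpa using h3⟩)
    ((a.measurable_integrand b p).smul measurable_kernLogDeriv).aestronglyMeasurable
    (by
      filter_upwards [a.one_le_prod b] with z hz q hq
      obtain ⟨b1, b2, b3⟩ := hball q hq
      have hz3 : 0 < z.1 + z.2 := by linarith [hz.1, hz.2]
      have hk := realKern_nonneg σ τ υ hz.1 hz.2
      have hlog : Real.log (z.1 + z.2) ≤ (z.1 + z.2) ^ ε / ε := Real.log_le_rpow_div hz3.le hε
      rw [norm_smul]
      calc ‖a.integrand b q z‖ * ‖kernLogDeriv z.1 z.2‖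
          ≤ (C * realKern σ τ υ z.1 z.2) * (3 * ((z.1 + z.2) ^ ε / ε)) := by
            gcongr
            · exact (hC q z hz.1 hz.2).trans
                (mul_le_mul_of_nonneg_left (realKern_antitone b1 b2 b3 hz.1 hz.2) hC0)
            · exact (norm_kernLogDeriv_le hz.1 hz.2).trans (by linarith)
        _ = 3 * C / ε * realKern σ τ (υ - ε) z.1 z.2 := by
            unfold realKern
            rw [show -(υ - ε) = -υ + ε by ring, Real.rpow_add hz3]
            ring)
    ((a.integrable_realKern b (by simp only [σ, υ]; linarith) (by simp only [τ, υ]; linarith)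
      (by simp only [σ, τ, υ]; linarith)).const_mul _)
    (by
      filter_upwards [a.one_le_prod b] with z hz q _
      have := (hasFDerivAt_kern q hz.1 hz.2).const_mul (a.w z.1 * b.w z.2)
      simpa only [integrand, smul_smul] using this)
  exact key.differentiableAt

end Weight

/-! ### Periodic Bernoulli functions and Euler–Maclaurin summation. -/

/-- The periodic Bernoulli function `B_k({x})`, with complex values. -/
def bernoulliPer (k : ℕ) (x : ℝ) : ℂ := (bernoulliFun k (Int.fract x) : ℝ)

lemma measurable_bernoulliPer (k : ℕ) : Measurable (bernoulliPer k) :=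
  Complex.measurable_ofReal.comp
    ((continuous_bernoulliFun k).measurable.comp measurable_fract)

lemma exists_norm_bernoulliPer_le (k : ℕ) : ∃ C : ℝ, ∀ x, ‖bernoulliPer k x‖ ≤ C := by
  obtain ⟨C, hC⟩ := (isCompact_Icc (a := (0 : ℝ)) (b := 1)).exists_bound_of_continuousOn
    (continuous_bernoulliFun k).continuousOn
  refine ⟨C, fun x => ?_⟩
  rw [bernoulliPer, Complex.norm_real]
  exact hC _ ⟨Int.fract_nonneg x, (Int.fract_lt_one x).le⟩

lemma bernoulliPer_zero (x : ℝ) : bernoulliPer 0 x = 1 := by simp [bernoulliPer]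

lemma integrableOn_bernoulliPer_mul (k : ℕ) {g : ℝ → ℂ} (hg : IntegrableOn g (Ioi 1)) :
    IntegrableOn (fun y => bernoulliPer k y * g y) (Ioi 1) := by
  obtain ⟨C, hC⟩ := exists_norm_bernoulliPer_le k
  exact hg.bdd_mul (measurable_bernoulliPer k).aestronglyMeasurable (Eventually.of_forall hC)

section EulerMaclaurin

variable {g g' : ℝ → ℂ}


/-- Inside the cell the integrand is the derivative of `B_{k+1}(y - (n+1)) g(y)`, because `B_{k+1}'
= (k+1) B_k`. The polynomial, unlike the periodic function, takes the value `B_{k+1}(1)` at the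
right end. -/
lemma integral_bernoulliPer_cell (k n : ℕ) (hg : ∀ y, 1 ≤ y → HasDerivAt g (g' y) y)
    (hc : ContinuousOn g' (Ici 1)) :
    ∫ y in ((n : ℝ) + 1)..((n + 1 : ℕ) + 1 : ℝ),
        (bernoulliPer (k + 1) y * g' y + (k + 1) * (bernoulliPer k y * g y)) =
      bernoulliFun (k + 1) 1 * g (n + 2) - bernoulliFun (k + 1) 0 * g (n + 1) := by
  have hle : (n : ℝ) + 1 ≤ (n + 1 : ℕ) + 1 := by push_cast; linarith
  have hsub : uIcc ((n : ℝ) + 1) ((n + 1 : ℕ) + 1) ⊆ Ici 1 := by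
    rw [uIcc_of_le hle]
    intro y hy
    have : (0 : ℝ) ≤ n := by positivity
    exact le_trans (by linarith) hy.1
  have hB : ∀ j : ℕ, Continuous fun y : ℝ => ((bernoulliFun j (y - (n + 1)) : ℝ) : ℂ) := fun j =>
    Complex.continuous_ofReal.comp ((continuous_bernoulliFun j).comp (by fun_prop))
  have hgc : ContinuousOn g (Ici 1) := fun y hy => (hg y hy).continuousAt.continuousWithinAt
  have e : ∫ y in ((n : ℝ) + 1)..((n + 1 : ℕ) + 1 : ℝ),
      (bernoulliPer (k + 1) y * g' y + (k + 1) * (bernoulliPer k y * g y)) =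
      ∫ y in ((n : ℝ) + 1)..((n + 1 : ℕ) + 1 : ℝ),
        ((k + 1) * (bernoulliFun k (y - (n + 1)) : ℝ) * g y
          + (bernoulliFun (k + 1) (y - (n + 1)) : ℝ) * g' y) := by
    refine intervalIntegral.integral_congr_Ioo_of_le hle fun y hy => ?_
    have hf : Int.fract y = y - (n + 1) := by
      rw [Int.fract_eq_iff]
      push_cast at hy
      exact ⟨by linarith [hy.1], by linarith [hy.2], n + 1, by push_cast; ring⟩
    simp only [bernoulliPer, hf]
    ring
  rw [e, intervalIntegral.integral_eq_sub_of_hasDerivAt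
    (f := fun y => ((bernoulliFun (k + 1) (y - (n + 1)) : ℝ) : ℂ) * g y)]
  · push_cast
    rw [show (n : ℝ) + 1 + 1 - (n + 1) = 1 by ring, sub_self,
      show (n : ℝ) + 1 + 1 = n + 2 by ring]
  · intro y hy
    have h1 := ((hasDerivAt_bernoulliFun (k + 1) (y - (n + 1))).comp_sub_const y
      ((n : ℝ) + 1)).ofReal_comp
    refine (h1.mul (hg y (hsub hy))).congr_deriv ?_
    simp only [Nat.add_sub_cancel]
    push_cast
    rfl
  · refine ContinuousOn.intervalIntegrable ?_
    exact ((continuous_const.mul (hB k)).continuousOn.mul (hgc.mono hsub)).add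
      ((hB (k + 1)).continuousOn.mul (hc.mono hsub))

lemma tendsto_sum_bernoulliFun (k : ℕ) (hg : ∀ y, 1 ≤ y → HasDerivAt g (g' y) y)
    (hc : ContinuousOn g' (Ici 1)) (hi : IntegrableOn g (Ioi 1)) (hi' : IntegrableOn g' (Ioi 1)) :
    Tendsto (fun N : ℕ => ∑ n ∈ Finset.range N,
        (bernoulliFun (k + 1) 1 * g (n + 2) - bernoulliFun (k + 1) 0 * g (n + 1))) atTop
      (𝓝 ((∫ y in Ioi 1, bernoulliPer (k + 1) y * g' y)
        + (k + 1) * ∫ y in Ioi 1, bernoulliPer k y * g y)) := by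
  have h1 := integrableOn_bernoulliPer_mul (k + 1) hi'
  have h2 := (integrableOn_bernoulliPer_mul k hi).const_mul ((k : ℂ) + 1)
  have hadd := h1.add h2
  have hN : Tendsto (fun N : ℕ => (N : ℝ) + 1) atTop atTop :=
    tendsto_atTop_add_const_right _ _ tendsto_natCast_atTop_atTop
  have h := intervalIntegral_tendsto_integral_Ioi 1 hadd hN
  simp only [Pi.add_apply] at h
  rw [integral_add h1 h2, integral_const_mul] at h
  refine h.congr fun N => ?_
  have hs := intervalIntegral.sum_integral_adjacent_intervals (a := fun n : ℕ => (n : ℝ) + 1)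
    (n := N) (μ := volume)
    (f := fun y => bernoulliPer (k + 1) y * g' y + (k + 1) * (bernoulliPer k y * g y)) (by
      intro n _
      rw [intervalIntegrable_iff_integrableOn_Ioc_of_le (by push_cast; linarith)]
      refine hadd.mono_set fun y hy => ?_
      have : (0 : ℝ) ≤ n := by positivity
      exact lt_of_le_of_lt (by linarith) hy.1)
  simp only [Nat.cast_zero, zero_add] at hs
  rw [← hs]
  exact Finset.sum_congr rfl fun n _ => integral_bernoulliPer_cell k n hg hc

lemma tendsto_natCast_add_one (hlim : Tendsto g atTop (𝓝 0)) :
    Tendsto (fun N : ℕ => g (N + 1)) atTop (𝓝 0) :=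
  hlim.comp (tendsto_atTop_add_const_right _ _ tendsto_natCast_atTop_atTop)

lemma sum_range_shift_sub (N : ℕ) :
    ∑ n ∈ Finset.range N, (g ((n : ℝ) + 2) - g (n + 1)) = g (N + 1) - g 1 := by
  have := Finset.sum_range_sub (fun n : ℕ => g (n + 1)) N
  simp only [Nat.cast_zero, zero_add] at this
  rw [← this]
  refine Finset.sum_congr rfl fun n _ => ?_
  push_cast
  rw [show (n : ℝ) + 1 + 1 = n + 2 by ring]

/-- Integration by parts against `B_k({y})` for `k ≥ 1`. -/
lemma integral_bernoulliPer_mul (k : ℕ) (hg : ∀ y, 1 ≤ y → HasDerivAt g (g' y) y)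
    (hc : ContinuousOn g' (Ici 1)) (hi : IntegrableOn g (Ioi 1)) (hi' : IntegrableOn g' (Ioi 1))
    (hlim : Tendsto g atTop (𝓝 0)) :
    (∫ y in Ioi 1, bernoulliPer (k + 2) y * g' y)
        + (k + 2) * ∫ y in Ioi 1, bernoulliPer (k + 1) y * g y = -bernoulliFun (k + 2) 0 * g 1 := by
  have h := tendsto_sum_bernoulliFun (k + 1) hg hc hi hi'
  have h2 : Tendsto (fun N : ℕ => (bernoulliFun (k + 2) 0 : ℂ) * (g (N + 1) - g 1)) atTop
      (𝓝 (bernoulliFun (k + 2) 0 * (0 - g 1))) :=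
    ((tendsto_natCast_add_one hlim).sub_const _).const_mul _
  have h3 := tendsto_nhds_unique h (h2.congr fun N => ?_)
  · push_cast at h3
    rw [show (k : ℂ) + 2 = k + 1 + 1 by ring, h3]
    ring
  · rw [← sum_range_shift_sub, Finset.mul_sum]
    refine Finset.sum_congr rfl fun n _ => ?_
    -- From index `2` on, `B_j(0) = B_j(1)`, so the boundary terms telescope and only the one at `1`
    -- survives.
    rw [show k + 1 + 1 = k + 2 from rfl,
      bernoulliFun_endpoints_eq_of_ne_one (k := k + 2) (by omega)]
    ring

/-- The first-order Euler-Maclaurin formula. -/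
lemma tsum_eq_integral_add (hg : ∀ y, 1 ≤ y → HasDerivAt g (g' y) y)
    (hc : ContinuousOn g' (Ici 1)) (hi : IntegrableOn g (Ioi 1)) (hi' : IntegrableOn g' (Ioi 1))
    (hlim : Tendsto g atTop (𝓝 0)) (hs : Summable fun n : ℕ => g (n + 1)) :
    ∑' n : ℕ, g (n + 1) = (∫ y in Ioi 1, bernoulliPer 0 y * g y) + 1 / 2 * g 1
      + ∫ y in Ioi 1, bernoulliPer 1 y * g' y := by
  have h := tendsto_sum_bernoulliFun 0 hg hc hi hi'
  -- Since `B_1(1) = 1/2 = -B_1(0)`, each cell contributes `(g(n+2) + g(n+1))/2`, that is, `g(n+1)`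
  -- plus half a telescoping difference.
  have h2 := (hs.hasSum.tendsto_sum_nat).add
    (((tendsto_natCast_add_one hlim).sub_const (g 1)).const_mul (1 / 2))
  have h3 := tendsto_nhds_unique h (h2.congr fun N => ?_)
  · push_cast at h3
    linear_combination -h3
  · rw [← sum_range_shift_sub, Finset.mul_sum, ← Finset.sum_add_distrib]
    refine Finset.sum_congr rfl fun n _ => ?_
    simp only [zero_add, bernoulliFun_one]
    push_cast
    ring

end EulerMaclaurin

/-! ### The weights in use, and `J` as an iterated integral. -/

namespace Weight

/-- Lebesgue measure on `(1, ∞)` with the periodic Bernoulli function `B_k({x})` as weight. -/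
def bern (k : ℕ) : Weight where
  μ := volume.restrict (Ioi 1)
  w := bernoulliPer k
  sfinite := inferInstance
  one_le := (ae_restrict_mem measurableSet_Ioi).mono fun _ hx => le_of_lt hx
  integrable_rpow _ ha := integrableOn_Ioi_rpow_of_lt (by linarith) one_pos
  measurable_w := measurable_bernoulliPer k
  bounded_w := exists_norm_bernoulliPer_le k

/-- The point mass at `1`. -/
def unit : Weight where
  μ := Measure.dirac 1
  w := 1
  sfinite := inferInstance
  one_le := by simp [ae_dirac_eq]
  integrable_rpow a _ := integrable_dirac (by simp)
  measurable_w := measurable_const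
  bounded_w := ⟨1, by simp⟩

lemma summable_nat_add_one_rpow {a : ℝ} (ha : 1 < a) :
    Summable fun n : ℕ => ((n : ℝ) + 1) ^ (-a) := by
  refine ((Real.summable_one_div_nat_add_rpow 1 a).2 ha).congr fun n => ?_
  have : (0 : ℝ) < n + 1 := by positivity
  rw [abs_of_pos this, Real.rpow_neg this.le, one_div]

lemma measurableEmbedding_nat_add_one : MeasurableEmbedding (fun n : ℕ => (n : ℝ) + 1) where
  injective := fun m n h => by simpa using h
  measurable := by fun_prop
  measurableSet_image' := fun _ _ => ((Set.to_countable _).image _).measurableSet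

/-- The counting measure of the positive integers. -/
def counting : Weight where
  μ := Measure.map (fun n : ℕ => (n : ℝ) + 1) Measure.count
  w := 1
  sfinite := inferInstance
  one_le := by
    rw [measurableEmbedding_nat_add_one.ae_map_iff]
    exact Eventually.of_forall fun n => by simp
  integrable_rpow a ha := by
    rw [measurableEmbedding_nat_add_one.integrable_map_iff, integrable_count_iff]
    exact (summable_nat_add_one_rpow ha).norm
  measurable_w := measurable_const
  bounded_w := ⟨1, by simp⟩

/-- The inner integral of `J`. -/
def inner (b : Weight) (p : ℂ × ℂ × ℂ) (x : ℝ) : ℂ := ∫ y, b.w y * kern p x y ∂b.μ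

/-- Decay strictly faster than `y⁻¹` gives integrability in `y`, and also kills the boundary terms
at infinity, including that of `y` times the kernel. -/
lemma exists_norm_kern_le {p : ℂ × ℂ × ℂ} (hp : p ∈ convergenceRegion) {x : ℝ} (hx : 1 ≤ x) :
    ∃ C c : ℝ, 0 ≤ C ∧ 1 < c ∧ ∀ y, 1 ≤ y → ‖kern p x y‖ ≤ C * y ^ (-c) := by
  obtain ⟨h1, h2, h3⟩ := hp
  simp only [Complex.add_re] at h1 h2 h3
  obtain ⟨C, a, b, a', b', -, hb, -, hb', h⟩ := exists_realKern_le h1 h2 h3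
  refine ⟨|C| * (x ^ (-a) + x ^ (-a')), min b b', by positivity, lt_min hb hb', fun y hy => ?_⟩
  rw [norm_kern p hx hy]
  refine (h x y hx hy).trans ?_
  rw [mul_assoc, add_mul]
  gcongr
  · exact le_abs_self C
  · exact min_le_left _ _
  · exact min_le_right _ _

lemma integrable_kern (b : Weight) {p : ℂ × ℂ × ℂ} (hp : p ∈ convergenceRegion) {x : ℝ}
    (hx : 1 ≤ x) : Integrable (kern p x) b.μ := by
  obtain ⟨C, c, -, hc, h⟩ := exists_norm_kern_le hp hx
  refine ((b.integrable_rpow c hc).const_mul C).mono' ?_ (b.one_le.mono h)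
  unfold kern
  exact Measurable.aestronglyMeasurable (by fun_prop)

lemma integrable_mul_inner (a b : Weight) {p : ℂ × ℂ × ℂ} (hp : p ∈ convergenceRegion) :
    Integrable (fun x => a.w x * b.inner p x) a.μ := by
  refine (a.integrable_integrand b hp).integral_prod_left.congr (Eventually.of_forall fun x => ?_)
  simp only [integrand, inner, mul_assoc]
  rw [integral_const_mul]

lemma J_eq_integral_inner (a b : Weight) {p : ℂ × ℂ × ℂ} (hp : p ∈ convergenceRegion) :
    a.J b p = ∫ x, a.w x * b.inner p x ∂a.μ := by
  rw [J, integral_prod _ (a.integrable_integrand b hp)]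
  refine integral_congr_ae (Eventually.of_forall fun x => ?_)
  simp only [integrand, inner, mul_assoc]
  rw [integral_const_mul]

lemma J_swap (a b : Weight) (s t u : ℂ) : a.J b (s, t, u) = b.J a (t, s, u) := by
  rw [J, J, ← integral_prod_swap]
  refine integral_congr_ae (Eventually.of_forall fun z => ?_)
  simp only [integrand, kern, Prod.fst_swap, Prod.snd_swap, add_comm z.2 z.1]
  ring

lemma inner_unit (p : ℂ × ℂ × ℂ) (x : ℝ) : unit.inner p x = kern p x 1 := by
  simp [inner, unit]

/-- All mass sits at `x = 1`, where `x^{-s} = 1`. This freedom in `s` later turns translations that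
fail to raise `s + u` into ones that do. -/
lemma J_unit_congr (b : Weight) {s s' t u : ℂ} : unit.J b (s, t, u) = unit.J b (s', t, u) := by
  refine integral_congr_ae ?_
  filter_upwards [Measure.quasiMeasurePreserving_fst.ae (show ∀ᵐ x ∂unit.μ, x = 1 by
    simp [unit, ae_dirac_eq])] with z hz
  simp [integrand, kern, hz]

lemma J_unit_unit {s t u : ℂ} (hp : (s, t, u) ∈ convergenceRegion) :
    unit.J unit (s, t, u) = 2 ^ (-u) := by
  rw [J_eq_integral_inner _ _ hp]
  simp only [inner_unit]
  simp [unit, kern]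
  norm_num

/-! ### Recurrences from integration by parts. -/

section Recurrences

variable {s t u : ℂ}

lemma mem_convergenceRegion_add {p d : ℂ × ℂ × ℂ} (hp : p ∈ convergenceRegion)
    (h1 : 0 ≤ (d.1 + d.2.2).re) (h2 : 0 ≤ (d.2.1 + d.2.2).re)
    (h3 : 0 ≤ (d.1 + d.2.1 + d.2.2).re) : p + d ∈ convergenceRegion := by
  obtain ⟨a, b, c⟩ := hp
  simp only [Complex.add_re] at a b c h1 h2 h3
  refine ⟨?_, ?_, ?_⟩ <;> simp only [Prod.fst_add, Prod.snd_add, Complex.add_re] <;> linarith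

lemma mem_convergenceRegion_t (hp : (s, t, u) ∈ convergenceRegion) :
    (s, t + 1, u) ∈ convergenceRegion := by
  simpa using mem_convergenceRegion_add (d := (0, 1, 0)) hp (by simp) (by simp) (by simp)

lemma mem_convergenceRegion_u (hp : (s, t, u) ∈ convergenceRegion) :
    (s, t, u + 1) ∈ convergenceRegion := by
  simpa using mem_convergenceRegion_add (d := (0, 0, 1)) hp (by simp) (by simp) (by simp)

lemma mem_convergenceRegion_su (hp : (s, t, u) ∈ convergenceRegion) :
    (s - 1, t, u + 1) ∈ convergenceRegion := by
  simpa [sub_eq_add_neg] using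
    mem_convergenceRegion_add (d := (-1, 0, 1)) hp (by simp) (by simp) (by simp)

lemma hasDerivAt_kern_right (s t u : ℂ) {x y : ℝ} (hx : 1 ≤ x) (hy : 1 ≤ y) :
    HasDerivAt (kern (s, t, u) x) (-t * kern (s, t + 1, u) x y - u * kern (s, t, u + 1) x y) y := by
  have h2 : (y : ℂ) ∈ Complex.slitPlane := by
    rw [Complex.ofReal_mem_slitPlane]; linarith
  have h3 : ((x + y : ℝ) : ℂ) ∈ Complex.slitPlane := by
    rw [Complex.ofReal_mem_slitPlane]; linarith
  have d2 : HasDerivAt (fun y : ℝ => (y : ℂ) ^ (-t)) (-t * (y : ℂ) ^ (-t - 1) * (1 : ℝ)) y :=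
    by simpa using ((hasDerivAt_id (y : ℂ)).cpow_const (c := -t) h2).comp_ofReal
  have d3 : HasDerivAt (fun y : ℝ => ((x + y : ℝ) : ℂ) ^ (-u))
      (-u * ((x + y : ℝ) : ℂ) ^ (-u - 1) * (1 : ℝ)) y := by
    rw [Complex.ofReal_add] at h3
    simpa using (((hasDerivAt_id (y : ℂ)).const_add (x : ℂ)).cpow_const (c := -u) h3).comp_ofReal
  have := (d2.const_mul ((x : ℂ) ^ (-s))).mul d3
  refine this.congr_deriv ?_
  simp only [kern, Complex.ofReal_one]
  rw [show -(t + 1) = -t - 1 by ring, show -(u + 1) = -u - 1 by ring]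
  ring

lemma continuousOn_kern (p : ℂ × ℂ × ℂ) {x : ℝ} (hx : 1 ≤ x) : ContinuousOn (kern p x) (Ici 1) :=
  fun _ hy => (hasDerivAt_kern_right p.1 p.2.1 p.2.2 hx hy).continuousAt.continuousWithinAt

lemma tendsto_rpow_neg_atTop_mul (C : ℝ) {c : ℝ} (hc : 0 < c) :
    Tendsto (fun y : ℝ => C * y ^ (-c)) atTop (𝓝 0) := by
  simpa using (tendsto_rpow_neg_atTop hc).const_mul C

lemma tendsto_kern (hp : (s, t, u) ∈ convergenceRegion) {x : ℝ} (hx : 1 ≤ x) :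
    Tendsto (kern (s, t, u) x) atTop (𝓝 0) := by
  obtain ⟨C, c, -, hc, h⟩ := exists_norm_kern_le hp hx
  exact squeeze_zero_norm' ((eventually_ge_atTop 1).mono h)
    (tendsto_rpow_neg_atTop_mul C (by linarith))

lemma tendsto_mul_kern (hp : (s, t, u) ∈ convergenceRegion) {x : ℝ} (hx : 1 ≤ x) :
    Tendsto (fun y : ℝ => (y : ℂ) * kern (s, t, u) x y) atTop (𝓝 0) := by
  obtain ⟨C, c, -, hc, h⟩ := exists_norm_kern_le hp hx
  refine squeeze_zero_norm' ((eventually_ge_atTop 1).mono fun y hy => ?_)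
    (tendsto_rpow_neg_atTop_mul C (c := c - 1) (by linarith))
  have hy0 : 0 < y := by linarith
  rw [norm_mul, Complex.norm_real, Real.norm_of_nonneg hy0.le]
  refine (mul_le_mul_of_nonneg_left (h y hy) hy0.le).trans (le_of_eq ?_)
  rw [show -(c - 1) = -c + 1 by ring, Real.rpow_add hy0, Real.rpow_one]
  ring

lemma continuousOn_deriv_kern (s t u : ℂ) {x : ℝ} (hx : 1 ≤ x) :
    ContinuousOn (fun y => -t * kern (s, t + 1, u) x y - u * kern (s, t, u + 1) x y) (Ici 1) :=
  ((continuousOn_kern _ hx).const_mul _).sub ((continuousOn_kern _ hx).const_mul _)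

lemma integrableOn_deriv_kern (hp : (s, t, u) ∈ convergenceRegion) {x : ℝ} (hx : 1 ≤ x) :
    IntegrableOn (fun y => -t * kern (s, t + 1, u) x y - u * kern (s, t, u + 1) x y) (Ioi 1) :=
  (((bern 0).integrable_kern (mem_convergenceRegion_t hp) hx).const_mul _).sub
    (((bern 0).integrable_kern (mem_convergenceRegion_u hp) hx).const_mul _)

lemma inner_bern (k : ℕ) (p : ℂ × ℂ × ℂ) (x : ℝ) :
    (bern k).inner p x = ∫ y in Ioi 1, bernoulliPer k y * kern p x y := rfl

lemma integral_bern_deriv_kern (k : ℕ) (hp : (s, t, u) ∈ convergenceRegion) {x : ℝ} (hx : 1 ≤ x) :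
    ∫ y in Ioi 1, bernoulliPer k y *
        (-t * kern (s, t + 1, u) x y - u * kern (s, t, u + 1) x y) =
      -t * (bern k).inner (s, t + 1, u) x - u * (bern k).inner (s, t, u + 1) x := by
  have i1 := integrableOn_bernoulliPer_mul k
    ((bern 0).integrable_kern (mem_convergenceRegion_t hp) hx)
  have i2 := integrableOn_bernoulliPer_mul k
    ((bern 0).integrable_kern (mem_convergenceRegion_u hp) hx)
  rw [inner_bern, inner_bern, ← integral_const_mul, ← integral_const_mul,
    ← integral_sub (i1.const_mul _) (i2.const_mul _)]
  refine integral_congr_ae (Eventually.of_forall fun y => ?_)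
  simp only
  ring

lemma inner_bern_succ (k : ℕ) (hp : (s, t, u) ∈ convergenceRegion) {x : ℝ} (hx : 1 ≤ x) :
    (k + 2) * (bern (k + 1)).inner (s, t, u) x =
      -bernoulliFun (k + 2) 0 * unit.inner (s, t, u) x
      + t * (bern (k + 2)).inner (s, t + 1, u) x + u * (bern (k + 2)).inner (s, t, u + 1) x := by
  have h := integral_bernoulliPer_mul k (fun y hy => hasDerivAt_kern_right s t u hx hy)
    (continuousOn_deriv_kern s t u hx) ((bern 0).integrable_kern hp hx)
    (integrableOn_deriv_kern hp hx) (tendsto_kern hp hx)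
  rw [integral_bern_deriv_kern _ hp hx, ← inner_bern] at h
  rw [inner_unit]
  linear_combination h

lemma summable_kern (hp : (s, t, u) ∈ convergenceRegion) {x : ℝ} (hx : 1 ≤ x) :
    Summable fun n : ℕ => kern (s, t, u) x (n + 1) := by
  have h := counting.integrable_kern hp hx
  rw [counting, measurableEmbedding_nat_add_one.integrable_map_iff, integrable_count_iff] at h
  exact h.of_norm

lemma inner_counting (hp : (s, t, u) ∈ convergenceRegion) {x : ℝ} (hx : 1 ≤ x) :
    counting.inner (s, t, u) x = ∑' n : ℕ, kern (s, t, u) x (n + 1) := by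
  have h := counting.integrable_kern hp hx
  rw [counting, measurableEmbedding_nat_add_one.integrable_map_iff] at h
  simp only [inner, counting, Pi.one_apply, one_mul]
  rw [measurableEmbedding_nat_add_one.integral_map]
  exact (integral_countable h).trans (by simp)

lemma inner_counting_eq (hp : (s, t, u) ∈ convergenceRegion) {x : ℝ} (hx : 1 ≤ x) :
    counting.inner (s, t, u) x = (bern 0).inner (s, t, u) x + 1 / 2 * unit.inner (s, t, u) x
      + (-t * (bern 1).inner (s, t + 1, u) x - u * (bern 1).inner (s, t, u + 1) x) := by
  rw [inner_counting hp hx, inner_unit, inner_bern 0, ← integral_bern_deriv_kern _ hp hx]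
  exact tsum_eq_integral_add (fun y hy => hasDerivAt_kern_right s t u hx hy)
    (continuousOn_deriv_kern s t u hx) ((bern 0).integrable_kern hp hx)
    (integrableOn_deriv_kern hp hx) (tendsto_kern hp hx) (summable_kern hp hx)

lemma kern_shift_s (s t u : ℂ) {x y : ℝ} (hx : 1 ≤ x) :
    kern (s - 1, t, u) x y = x * kern (s, t, u) x y := by
  have h : (x : ℂ) ≠ 0 := by norm_cast; linarith
  simp only [kern, neg_sub, sub_eq_add_neg (1 : ℂ) s, add_comm (1 : ℂ) (-s),
    Complex.cpow_add _ _ h, Complex.cpow_one]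
  ring

lemma kern_swap (s t u : ℂ) (x y : ℝ) : kern (s, t, u) x y = kern (t, s, u) y x := by
  simp only [kern, add_comm x y]; ring

lemma kern_shift_t (s t u : ℂ) {x y : ℝ} (hy : 1 ≤ y) :
    kern (s, t - 1, u) x y = y * kern (s, t, u) x y := by
  rw [kern_swap, kern_shift_s _ _ _ hy, kern_swap]

lemma kern_shift_u (s t u : ℂ) {x y : ℝ} (hx : 1 ≤ x) (hy : 1 ≤ y) :
    kern (s, t, u) x y = (x + y) * kern (s, t, u + 1) x y := by
  have h : ((x + y : ℝ) : ℂ) ≠ 0 := by norm_cast; linarith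
  have : ((x + y : ℝ) : ℂ) ^ (-u) = (x + y) * ((x + y : ℝ) : ℂ) ^ (-(u + 1)) := by
    rw [show -u = -(u + 1) + 1 by ring, Complex.cpow_add _ _ h, Complex.cpow_one]
    push_cast; ring
  simp only [kern, this]
  ring

/-- Integrate the derivative of `y` times the kernel over `(1, ∞)`. Writing `y = (x + y) - x` in the
term where `(x+y)^{-u}` is differentiated turns it into a multiple of the kernel and a term with
exponents `(s - 1, t, u + 1)`. -/
lemma inner_bern_zero (hp : (s, t, u) ∈ convergenceRegion) {x : ℝ} (hx : 1 ≤ x) :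
    (t + u - 1) * (bern 0).inner (s, t, u) x =
      u * (bern 0).inner (s - 1, t, u + 1) x + unit.inner (s, t, u) x := by
  have i1 := (bern 0).integrable_kern hp hx
  have i2 := (bern 0).integrable_kern (mem_convergenceRegion_su hp) hx
  have h := integral_Ioi_of_hasDerivAt_of_tendsto' (a := 1) (m := 0)
    (f := fun y : ℝ => (y : ℂ) * kern (s, t, u) x y)
    (f' := fun y : ℝ => (1 - t - u) * kern (s, t, u) x y + u * kern (s - 1, t, u + 1) x y)
    (fun y hy => by
      refine ((hasDerivAt_id y).ofReal_comp.mul (hasDerivAt_kern_right s t u hx hy)).congr_deriv ?_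
      have e1 := kern_shift_t s (t + 1) u (x := x) hy
      have e2 := kern_shift_s s t (u + 1) (y := y) hx
      have e3 := kern_shift_u s t u hx hy
      rw [add_sub_cancel_right] at e1
      simp only [id, Complex.ofReal_one]
      linear_combination t * e1 - u * e2 + u * e3)
    ((i1.const_mul _).add (i2.const_mul _)) (tendsto_mul_kern hp hx)
  change ∫ y, _ ∂(bern 0).μ = _ at h
  rw [integral_add (i1.const_mul _) (i2.const_mul _), integral_const_mul, integral_const_mul] at h
  have e : ∀ q, (bern 0).inner q x = ∫ y, kern q x y ∂(bern 0).μ := fun q => by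
    simp only [inner, bern, bernoulliPer_zero, one_mul]
  rw [e, e, inner_unit]
  simp only [Complex.ofReal_one, one_mul] at h
  linear_combination -h

lemma J_bern_succ (a : Weight) (k : ℕ) (hp : (s, t, u) ∈ convergenceRegion) :
    (k + 2) * a.J (bern (k + 1)) (s, t, u) = -bernoulliFun (k + 2) 0 * a.J unit (s, t, u)
      + t * a.J (bern (k + 2)) (s, t + 1, u) + u * a.J (bern (k + 2)) (s, t, u + 1) := by
  have hpt := mem_convergenceRegion_t hp
  have hpu := mem_convergenceRegion_u hp
  have i1 := (a.integrable_mul_inner unit hp).const_mul (-bernoulliFun (k + 2) 0 : ℂ)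
  have i2 := (a.integrable_mul_inner (bern (k + 2)) hpt).const_mul t
  have i3 := (a.integrable_mul_inner (bern (k + 2)) hpu).const_mul u
  rw [J_eq_integral_inner _ _ hp, J_eq_integral_inner _ _ hp, J_eq_integral_inner _ _ hpt,
    J_eq_integral_inner _ _ hpu, ← integral_const_mul, ← integral_const_mul,
    ← integral_const_mul, ← integral_const_mul, ← integral_add' i1 i2,
    ← integral_add' (i1.add i2) i3]
  refine integral_congr_ae (a.one_le.mono fun x hx => ?_)
  have := inner_bern_succ k hp hx
  simp only [Pi.add_apply]
  linear_combination a.w x * this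

lemma J_counting (a : Weight) (hp : (s, t, u) ∈ convergenceRegion) :
    a.J counting (s, t, u) = a.J (bern 0) (s, t, u) + 1 / 2 * a.J unit (s, t, u)
      + (-t) * a.J (bern 1) (s, t + 1, u) + (-u) * a.J (bern 1) (s, t, u + 1) := by
  have hpt := mem_convergenceRegion_t hp
  have hpu := mem_convergenceRegion_u hp
  have i0 := a.integrable_mul_inner (bern 0) hp
  have i1 := (a.integrable_mul_inner unit hp).const_mul (1 / 2)
  have i2 := (a.integrable_mul_inner (bern 1) hpt).const_mul (-t)
  have i3 := (a.integrable_mul_inner (bern 1) hpu).const_mul (-u)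
  rw [J_eq_integral_inner _ _ hp, J_eq_integral_inner _ _ hp, J_eq_integral_inner _ _ hp,
    J_eq_integral_inner _ _ hpt, J_eq_integral_inner _ _ hpu, ← integral_const_mul,
    ← integral_const_mul, ← integral_const_mul, ← integral_add' i0 i1,
    ← integral_add' (i0.add i1) i2, ← integral_add' ((i0.add i1).add i2) i3]
  refine integral_congr_ae (a.one_le.mono fun x hx => ?_)
  have := inner_counting_eq hp hx
  simp only [Pi.add_apply]
  linear_combination a.w x * this

lemma J_bern_zero (a : Weight) (hp : (s, t, u) ∈ convergenceRegion) :
    (t + u - 1) * a.J (bern 0) (s, t, u) =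
      u * a.J (bern 0) (s - 1, t, u + 1) + a.J unit (s, t, u) := by
  have hps := mem_convergenceRegion_su hp
  have i1 := (a.integrable_mul_inner (bern 0) hps).const_mul u
  have i2 := a.integrable_mul_inner unit hp
  rw [J_eq_integral_inner _ _ hp, J_eq_integral_inner _ _ hp, J_eq_integral_inner _ _ hps,
    ← integral_const_mul, ← integral_const_mul, ← integral_add i1 i2]
  refine integral_congr_ae (a.one_le.mono fun x hx => ?_)
  have := inner_bern_zero hp hx
  simp only
  linear_combination a.w x * this

/-- This is `x + y = (x + y)`: the two shifts multiply `kern (s, t, u + 1)` by `x` and by `y`. -/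
lemma J_add_J (a b : Weight) (hp : (s, t, u) ∈ convergenceRegion) :
    a.J b (s - 1, t, u + 1) + a.J b (s, t - 1, u + 1) = a.J b (s, t, u) := by
  have hp1 := mem_convergenceRegion_su hp
  have hp2 : (s, t - 1, u + 1) ∈ convergenceRegion := by
    simpa [sub_eq_add_neg] using
      mem_convergenceRegion_add (d := (0, -1, 1)) hp (by simp) (by simp) (by simp)
  rw [J, J, J, ← integral_add (a.integrable_integrand b hp1) (a.integrable_integrand b hp2)]
  refine integral_congr_ae ((a.one_le_prod b).mono fun z hz => ?_)
  simp only [integrand]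
  rw [kern_shift_s _ _ _ hz.1, kern_shift_t _ _ _ hz.2, kern_shift_u s t u hz.1 hz.2]
  ring

/-- The recurrences in `x` and in `y` are added. Their shifted terms recombine into `u` times the
original integral by `J_add_J`, leaving the coefficient `(t+u-1) + (s+u-1) - u`. -/
lemma J_bern_zero_bern_zero (hp : (s, t, u) ∈ convergenceRegion) :
    (s + t + u - 2) * (bern 0).J (bern 0) (s, t, u) =
      (bern 0).J unit (s, t, u) + (bern 0).J unit (t, s, u) := by
  have hp' : (t, s, u) ∈ convergenceRegion :=
    ⟨hp.2.1, hp.1, by have := hp.2.2; simp only [Complex.add_re] at this ⊢; linarith⟩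
  have h1 := J_bern_zero (bern 0) hp
  have h2 := J_bern_zero (bern 0) hp'
  rw [J_swap _ _ t s u, J_swap _ _ (t - 1) s (u + 1)] at h2
  linear_combination h1 + h2 + u * J_add_J (bern 0) (bern 0) hp

end Recurrences

/-! ### The double series as a double integral. -/

lemma kern_natCast (s t u : ℂ) (k : ℕ × ℕ) :
    kern (s, t, u) (k.1 + 1) (k.2 + 1) = tornheimTerm s t u k := by
  simp only [kern, tornheimTerm, Complex.cpow_neg]
  push_cast
  simp only [one_div, mul_inv]

/-- The double series converges absolutely, with sum the double integral against counting
measures. -/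
theorem hasSum_tornheimTerm {s t u : ℂ} (hp : (s, t, u) ∈ convergenceRegion) :
    HasSum (tornheimTerm s t u) (counting.J counting (s, t, u)) := by
  have hs : Summable (tornheimTerm s t u) := by
    obtain ⟨h1, h2, h3⟩ := hp
    simp only [Complex.add_re] at h1 h2 h3
    obtain ⟨C, a, b, a', b', ha, hb, ha', hb', h⟩ := exists_realKern_le h1 h2 h3
    have hprod : ∀ {a b : ℝ}, 1 < a → 1 < b →
        Summable fun k : ℕ × ℕ => ((k.1 : ℝ) + 1) ^ (-a) * ((k.2 : ℝ) + 1) ^ (-b) :=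
      fun ha hb => (summable_nat_add_one_rpow ha).mul_of_nonneg (summable_nat_add_one_rpow hb)
        (fun n => by positivity) (fun n => by positivity)
    refine Summable.of_norm_bounded (((hprod ha hb).add (hprod ha' hb')).mul_left C) fun k => ?_
    rw [← kern_natCast, norm_kern _ (by simp) (by simp)]
    exact h _ _ (by simp) (by simp)
  have hi := counting.integrable_mul_inner counting hp
  have hJ : counting.J counting (s, t, u) = ∑' k, tornheimTerm s t u k := by
    rw [J_eq_integral_inner _ _ hp, hs.tsum_prod]
    simp only [counting] at hi ⊢
    rw [measurableEmbedding_nat_add_one.integrable_map_iff] at hi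
    rw [measurableEmbedding_nat_add_one.integral_map]
    refine (integral_countable hi).trans (tsum_congr fun m => ?_)
    have := inner_counting hp (x := (m : ℝ) + 1) (by simp)
    simp only [counting] at this
    simp [this, ← kern_natCast]
  rw [hJ]
  exact hs.hasSum

end Weight

/-! ### The domains and their integer translations. -/

lemma isClosed_intsLeOne : IsClosed intsLeOne := by
  have h : intsLeOne = (fun n : ℤ => (n : ℂ)) '' {n | n ≤ 1} := by
    ext z
    simp only [intsLeOne, mem_ofPred_eq, mem_image]
    exact exists_congr fun n => and_congr_right fun _ => eq_comm
  rw [h]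
  have : Topology.IsClosedEmbedding (fun n : ℤ => (n : ℂ)) :=
    Complex.isometry_ofReal.isClosedEmbedding.comp Int.isClosedEmbedding_coe_real
  exact this.isClosedMap _ (isClosed_discrete _)

lemma isOpen_partlyRegularSet : IsOpen partlyRegularSet :=
  (isClosed_intsLeOne.isOpen_compl.preimage
    (f := fun p : ℂ × ℂ × ℂ => p.2.1 + p.2.2) (by fun_prop)).inter
    (isClosed_intsLeOne.isOpen_compl.preimage
      (f := fun p : ℂ × ℂ × ℂ => p.2.2 + p.1) (by fun_prop))

lemma not_mem_intsLeOne_of_one_lt {z : ℂ} (hz : 1 < z.re) : z ∉ intsLeOne := by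
  rintro ⟨n, hn, rfl⟩
  have : (n : ℝ) ≤ 1 := by exact_mod_cast hn
  simp only [Complex.intCast_re] at hz
  linarith

lemma add_intCast_not_mem_intsLeOne {z : ℂ} (hz : z ∉ intsLeOne) {n : ℤ} (hn : 0 ≤ n) :
    z + n ∉ intsLeOne := by
  rintro ⟨m, hm, h⟩
  exact hz ⟨m - n, by omega, by push_cast; linear_combination h⟩

lemma one_mem_intsLeOne : (1 : ℂ) ∈ intsLeOne := ⟨1, le_rfl, by simp⟩

lemma convergenceRegion_subset : convergenceRegion ⊆ partlyRegularSet := fun p hp =>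
  ⟨not_mem_intsLeOne_of_one_lt hp.2.1, not_mem_intsLeOne_of_one_lt (by rw [add_comm]; exact hp.1)⟩

/-- The region of convergence enlarged by `N` in each direction. -/
def enlarged (N : ℕ) : Set (ℂ × ℂ × ℂ) :=
  {p | 1 - (N : ℝ) < (p.1 + p.2.2).re ∧ 1 - (N : ℝ) < (p.2.1 + p.2.2).re ∧
    2 - (N : ℝ) < (p.1 + p.2.1 + p.2.2).re}

lemma enlarged_zero : enlarged 0 = convergenceRegion := by
  simp [enlarged, convergenceRegion]

lemma isOpen_enlarged (N : ℕ) : IsOpen (enlarged N) := by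
  have h (c : ℝ) (f : ℂ × ℂ × ℂ → ℂ) (hf : Continuous f) : IsOpen {p | c < (f p).re} :=
    isOpen_lt continuous_const (Complex.continuous_re.comp hf)
  exact (h _ _ (by fun_prop)).inter ((h _ _ (by fun_prop)).inter (h _ _ (by fun_prop)))

lemma enlarged_mono {M N : ℕ} (h : M ≤ N) : enlarged M ⊆ enlarged N := by
  have : (M : ℝ) ≤ N := by exact_mod_cast h
  rintro p ⟨h1, h2, h3⟩
  exact ⟨by linarith, by linarith, by linarith⟩

lemma exists_mem_enlarged (p : ℂ × ℂ × ℂ) : ∃ N, p ∈ enlarged N := by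
  obtain ⟨N, hN⟩ := exists_nat_gt (|(p.1 + p.2.2).re| + |(p.2.1 + p.2.2).re|
    + |(p.1 + p.2.1 + p.2.2).re| + 2)
  have h1 := neg_abs_le (p.1 + p.2.2).re
  have h2 := neg_abs_le (p.2.1 + p.2.2).re
  have h3 := neg_abs_le (p.1 + p.2.1 + p.2.2).re
  have a1 := abs_nonneg (p.1 + p.2.2).re
  have a2 := abs_nonneg (p.2.1 + p.2.2).re
  have a3 := abs_nonneg (p.1 + p.2.1 + p.2.2).re
  exact ⟨N, by linarith, by linarith, by linarith⟩

/-- An integer vector as a translation of `ℂ³`. -/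
def shift (d : ℤ × ℤ × ℤ) : ℂ × ℂ × ℂ := (d.1, d.2.1, d.2.2)

/-- Translation by `d` raises each of `s+u`, `t+u`, `s+t+u` by at least `e`. -/
def Raises (e : ℤ) (d : ℤ × ℤ × ℤ) : Prop :=
  e ≤ d.1 + d.2.2 ∧ e ≤ d.2.1 + d.2.2 ∧ e ≤ d.1 + d.2.1 + d.2.2

instance (e : ℤ) (d : ℤ × ℤ × ℤ) : Decidable (Raises e d) := by unfold Raises; infer_instance

lemma Raises.add_shift_mem_partlyRegularSet {d : ℤ × ℤ × ℤ} (hd : Raises 0 d) {p : ℂ × ℂ × ℂ}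
    (hp : p ∈ partlyRegularSet) : p + shift d ∈ partlyRegularSet := by
  constructor
  · have := add_intCast_not_mem_intsLeOne hp.1 hd.2.1
    convert this using 1
    simp only [shift, Prod.snd_add, Prod.fst_add]; push_cast; ring_nf
  · have := add_intCast_not_mem_intsLeOne hp.2 hd.1
    convert this using 1
    simp only [shift, Prod.snd_add, Prod.fst_add]; push_cast; ring_nf

lemma Raises.mono {e : ℤ} {d : ℤ × ℤ × ℤ} (hd : Raises 1 d) (he : e ≤ 1) : Raises e d :=
  ⟨he.trans hd.1, he.trans hd.2.1, he.trans hd.2.2⟩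

lemma Raises.add_shift_mem_enlarged {d : ℤ × ℤ × ℤ} {e : ℕ} (hd : Raises e d) {N : ℕ}
    {p : ℂ × ℂ × ℂ} (hp : p ∈ enlarged (N + e)) : p + shift d ∈ enlarged N := by
  obtain ⟨h1, h2, h3⟩ := hp
  obtain ⟨d1, d2, d3⟩ := hd
  have d1' : (e : ℝ) ≤ d.1 + d.2.2 := by exact_mod_cast d1
  have d2' : (e : ℝ) ≤ d.2.1 + d.2.2 := by exact_mod_cast d2
  have d3' : (e : ℝ) ≤ d.1 + d.2.1 + d.2.2 := by exact_mod_cast d3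
  push_cast at h1 h2 h3
  simp only [Complex.add_re] at h1 h2 h3
  refine ⟨?_, ?_, ?_⟩ <;>
  simp only [shift, Prod.snd_add, Prod.fst_add, Complex.add_re, Complex.intCast_re] <;> linarith

lemma Raises.add_shift_mem_convergenceRegion {d : ℤ × ℤ × ℤ} (hd : Raises 0 d) {p : ℂ × ℂ × ℂ}
    (hp : p ∈ convergenceRegion) : p + shift d ∈ convergenceRegion := by
  rw [← enlarged_zero] at hp ⊢
  exact Raises.add_shift_mem_enlarged (e := 0) hd hp

/-! ### Continuation by recurrences. -/

/-- `f` extends holomorphically from the region of convergence to `partlyRegularSet`. -/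
def Continues (f : ℂ × ℂ × ℂ → ℂ) : Prop :=
  ∃ G : ℂ × ℂ × ℂ → ℂ, DifferentiableOn ℂ G partlyRegularSet ∧ EqOn G f convergenceRegion

namespace Continues

variable {f g : ℂ × ℂ × ℂ → ℂ}

lemma congr (hf : Continues f) (h : EqOn f g convergenceRegion) : Continues g :=
  let ⟨G, hG, he⟩ := hf
  ⟨G, hG, he.trans h⟩

lemma of_differentiableOn (hf : DifferentiableOn ℂ f partlyRegularSet) : Continues f :=
  ⟨f, hf, fun _ _ => rfl⟩

lemma add (hf : Continues f) (hg : Continues g) : Continues (fun p => f p + g p) :=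
  let ⟨F, hF, ef⟩ := hf
  let ⟨G, hG, eg⟩ := hg
  ⟨fun p => F p + G p, hF.add hG, fun p hp => by simp only [ef hp, eg hp]⟩

lemma mul (hf : Continues f) (hg : Continues g) : Continues (fun p => f p * g p) :=
  let ⟨F, hF, ef⟩ := hf
  let ⟨G, hG, eg⟩ := hg
  ⟨fun p => F p * G p, hF.mul hG, fun p hp => by simp only [ef hp, eg hp]⟩

lemma comp_add_shift (hf : Continues f) {d : ℤ × ℤ × ℤ} (hd : Raises 0 d) :
    Continues (fun p => f (p + shift d)) :=
  let ⟨F, hF, ef⟩ := hf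
  ⟨fun p => F (p + shift d),
    hF.comp (by fun_prop) fun _ hp => hd.add_shift_mem_partlyRegularSet hp,
    fun _ hp => ef (hd.add_shift_mem_convergenceRegion hp)⟩

lemma comp_swap (hf : Continues f) : Continues (fun p => f (p.2.1, p.1, p.2.2)) :=
  let ⟨F, hF, ef⟩ := hf
  ⟨fun p => F (p.2.1, p.1, p.2.2),
    hF.comp (by fun_prop) fun p hp => ⟨by rw [add_comm]; exact hp.2, by rw [add_comm]; exact hp.1⟩,
    fun p hp => ef ⟨hp.2.1, hp.1, by have := hp.2.2; rwa [add_comm p.1] at this⟩⟩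

/-- A family of functions that satisfies an affine recurrence, with holomorphic coefficients and
translations that go deeper into the region of convergence, continues holomorphically. -/
theorem of_recurrence {ι : Type*} {r : ℕ} {F : ι → ℂ × ℂ × ℂ → ℂ}
    (hF : ∀ i, DifferentiableOn ℂ (F i) convergenceRegion) (next : ι → ι)
    (d : Fin r → ℤ × ℤ × ℤ) (hd : ∀ j, Raises 1 (d j)) {a : ι → ℂ × ℂ × ℂ → ℂ}
    (ha : ∀ i, Continues (a i)) (c : ι → Fin r → ℂ × ℂ × ℂ → ℂ)
    (hc : ∀ i j, DifferentiableOn ℂ (c i j) partlyRegularSet)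
    (hrec : ∀ i, ∀ p ∈ convergenceRegion,
      F i p = a i p + ∑ j, c i j p * F (next i) (p + shift (d j))) (i : ι) :
    Continues (F i) := by
  choose A hA hAa using ha
  -- `Φ` is the right side of the recurrence with its inhomogeneous term already continued. Each
  -- application gains one unit: holomorphy on `enlarged N` becomes holomorphy on `enlarged (N +
  -- 1)`.
  set Φ : (ι → ℂ × ℂ × ℂ → ℂ) → ι → ℂ × ℂ × ℂ → ℂ :=
    fun G i p => A i p + ∑ j, c i j p * G (next i) (p + shift (d j)) with hΦ
  have hmaps : ∀ N j, MapsTo (fun p => p + shift (d j)) (partlyRegularSet ∩ enlarged (N + 1))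
      (partlyRegularSet ∩ enlarged N) := fun N j p hp =>
    ⟨((hd j).mono zero_le_one).add_shift_mem_partlyRegularSet hp.1,
      Raises.add_shift_mem_enlarged (e := 1) (hd j) hp.2⟩
  have hdiff : ∀ N i, DifferentiableOn ℂ (Φ^[N] F i) (partlyRegularSet ∩ enlarged N) := by
    intro N
    induction N with
    | zero => exact fun i => (hF i).mono (by rw [enlarged_zero]; exact inter_subset_right)
    | succ N ih =>
      intro i
      rw [Function.iterate_succ_apply']
      refine ((hA i).mono inter_subset_left).add (DifferentiableOn.fun_sum fun j _ => ?_)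
      exact ((hc i j).mono inter_subset_left).mul ((ih (next i)).comp (by fun_prop) (hmaps N j))
  -- Consecutive iterates agree pointwise: the base case is the recurrence itself, and `Φ` carries
  -- agreement outward. No identity theorem is needed for the gluing.
  have hstep : ∀ N i, EqOn (Φ^[N + 1] F i) (Φ^[N] F i) (partlyRegularSet ∩ enlarged N) := by
    intro N
    induction N with
    | zero =>
      rintro i p ⟨-, hp⟩
      rw [enlarged_zero] at hp
      simp only [zero_add, Function.iterate_one, Function.iterate_zero, id_eq, hΦ]
      rw [hrec i p hp, hAa i hp]
    | succ N ih =>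
      intro i p hp
      rw [Function.iterate_succ_apply' Φ (N + 1)]
      conv_rhs => rw [Function.iterate_succ_apply']
      change A i p + ∑ j, c i j p * Φ^[N + 1] F (next i) (p + shift (d j)) =
        A i p + ∑ j, c i j p * Φ^[N] F (next i) (p + shift (d j))
      congr 1
      exact Finset.sum_congr rfl fun j _ => congrArg _ (ih (next i) (hmaps N j hp))
  have hstable : ∀ M k i, EqOn (Φ^[M + k] F i) (Φ^[M] F i) (partlyRegularSet ∩ enlarged M) := by
    intro M k
    induction k with
    | zero => exact fun i p _ => rfl
    | succ k ih =>
      exact fun i p hp => (hstep (M + k) i ⟨hp.1, enlarged_mono (by omega) hp.2⟩).trans (ih i hp)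
  choose n hn using exists_mem_enlarged
  have hG : ∀ M, EqOn (fun p => Φ^[n p] F i p) (Φ^[M] F i) (partlyRegularSet ∩ enlarged M) := by
    intro M p hp
    rcases le_total M (n p) with h | h
    · obtain ⟨k, hk⟩ := Nat.exists_eq_add_of_le h
      simp only [hk]
      exact hstable M k i hp
    · obtain ⟨k, hk⟩ := Nat.exists_eq_add_of_le h
      rw [hk]
      exact (hstable (n p) k i ⟨hp.1, hn p⟩).symm
  refine ⟨fun p => Φ^[n p] F i p, fun p hp => ?_, fun p hp => ?_⟩
  · have ho := (isOpen_partlyRegularSet.inter (isOpen_enlarged (n p))).mem_nhds ⟨hp, hn p⟩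
    exact ((((hdiff (n p) i).differentiableAt ho).congr_of_eventuallyEq
      ((hG (n p)).eventuallyEq_of_mem ho)).differentiableWithinAt)
  · exact hG 0 ⟨convergenceRegion_subset hp, by rwa [enlarged_zero]⟩

end Continues

/-! ### Continuation of each double integral. -/

lemma t_add_u_sub_one_ne_zero {p : ℂ × ℂ × ℂ} (hp : p ∈ partlyRegularSet) :
    p.2.1 + p.2.2 - 1 ≠ 0 := fun h =>
  hp.1 (by rw [sub_eq_zero.1 h]; exact one_mem_intsLeOne)

lemma natCast_add_two_ne_zero (k : ℕ) : (k : ℂ) + 2 ≠ 0 := by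
  exact_mod_cast (by omega : k + 2 ≠ 0)

lemma differentiableOn_div {f g : ℂ × ℂ × ℂ → ℂ} {Ω : Set (ℂ × ℂ × ℂ)}
    (hf : DifferentiableOn ℂ f Ω) (hg : DifferentiableOn ℂ g Ω) (h0 : ∀ p ∈ Ω, g p ≠ 0) :
    DifferentiableOn ℂ (fun p => f p / g p) Ω := by
  simp only [div_eq_mul_inv]
  exact hf.mul (hg.inv h0)

lemma differentiableOn_div_const {f : ℂ × ℂ × ℂ → ℂ} (hf : Differentiable ℂ f) (c : ℂ)
    (Ω : Set (ℂ × ℂ × ℂ)) : DifferentiableOn ℂ (fun p => f p / c) Ω := by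
  simp only [div_eq_mul_inv]
  exact (hf.mul_const _).differentiableOn

namespace Weight

lemma J_bern_succ_left (b : Weight) (k : ℕ) {s t u : ℂ} (hp : (s, t, u) ∈ convergenceRegion) :
    (k + 2) * (bern (k + 1)).J b (s, t, u) = -bernoulliFun (k + 2) 0 * unit.J b (s, t, u)
      + s * (bern (k + 2)).J b (s + 1, t, u) + u * (bern (k + 2)).J b (s, t, u + 1) := by
  have hp' : (t, s, u) ∈ convergenceRegion :=
    ⟨hp.2.1, hp.1, by have := hp.2.2; rwa [add_comm s] at this⟩
  simp only [J_swap _ b]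
  exact J_bern_succ b k hp'

lemma Continues.J_swap {a b : Weight} (h : Continues (a.J b)) : Continues (b.J a) :=
  h.comp_swap.congr fun _ _ => Weight.J_swap _ _ _ _ _

lemma continues_J_unit_unit : Continues (unit.J unit) := by
  refine (Continues.of_differentiableOn (f := fun p => (2 : ℂ) ^ (-p.2.2)) ?_).congr
    fun _ hp => (J_unit_unit hp).symm
  exact DifferentiableOn.const_cpow (by fun_prop) (Or.inl two_ne_zero)

lemma continues_J_unit_bern_zero : Continues (unit.J (bern 0)) := by
  refine Continues.of_recurrence (ι := Unit) (F := fun _ => unit.J (bern 0))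
    -- The recurrence translates by `(-1, 0, 1)`, which does not raise `s + u`; as the first
    -- exponent is irrelevant here, `(0, 0, 1)` serves instead.
    (fun _ => differentiableOn_J _ _) id ![(0, 0, 1)] (by decide)
    (a := fun _ p => 1 / (p.2.1 + p.2.2 - 1) * unit.J unit p)
    (fun _ => (Continues.of_differentiableOn ?_).mul continues_J_unit_unit)
    (fun _ _ p => p.2.2 / (p.2.1 + p.2.2 - 1)) (fun _ _ => ?_) ?_ ()
  · refine differentiableOn_div ?_ ?_ fun _ => t_add_u_sub_one_ne_zero <;> fun_prop
  · refine differentiableOn_div ?_ ?_ fun _ => t_add_u_sub_one_ne_zero <;> fun_prop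
  · rintro - ⟨s, t, u⟩ hp
    have h0 := t_add_u_sub_one_ne_zero (convergenceRegion_subset hp)
    have h := J_bern_zero unit hp
    rw [J_unit_congr (s := s - 1) (s' := s)] at h
    simp only [Finset.univ_unique, Finset.sum_singleton, Fin.default_eq_zero, Matrix.cons_val_zero,
      shift, Prod.mk_add_mk, Int.cast_zero, Int.cast_one, add_zero]
    simp only at h0
    field_simp
    linear_combination h

lemma continues_J_unit_bern_succ (k : ℕ) : Continues (unit.J (bern (k + 1))) := by
  refine Continues.of_recurrence (F := fun k => unit.J (bern (k + 1)))
    -- Here `(0, 1, 0)` has been replaced by `(1, 1, 0)`, again because the first exponent is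
    -- irrelevant.
    (fun _ => differentiableOn_J _ _) (· + 1) ![(1, 1, 0), (0, 0, 1)] (by decide)
    (a := fun k p => -bernoulliFun (k + 2) 0 / (k + 2) * unit.J unit p)
    (fun k => (Continues.of_differentiableOn (differentiableOn_const _)).mul continues_J_unit_unit)
    (fun k => ![fun p => p.2.1 / (k + 2), fun p => p.2.2 / (k + 2)])
    (fun k => Fin.forall_fin_two.2 ⟨?_, ?_⟩) ?_ k
  · exact differentiableOn_div_const (by fun_prop) _ _
  · exact differentiableOn_div_const (by fun_prop) _ _
  · rintro k ⟨s, t, u⟩ hp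
    have h0 := natCast_add_two_ne_zero k
    have h := J_bern_succ unit k hp
    rw [J_unit_congr (s := s) (s' := s + 1) (t := t + 1)] at h
    simp only [Fin.sum_univ_two, Matrix.cons_val_zero, Matrix.cons_val_one,
      shift, Prod.mk_add_mk, Int.cast_zero, Int.cast_one, add_zero]
    field_simp
    linear_combination h

lemma continues_J_unit_bern (k : ℕ) : Continues (unit.J (bern k)) := by
  cases k with
  | zero => exact continues_J_unit_bern_zero
  | succ k => exact continues_J_unit_bern_succ k

/-- The recurrence in `y` alone translates by `(-1, 0, 1)` and makes no progress in `s + u`. A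
further integration by parts in `x`, which raises the Bernoulli index, turns this into `(0, 0, 1)`
and `(-1, 0, 2)`. -/
lemma continues_J_bern_succ_bern_zero (k : ℕ) : Continues ((bern (k + 1)).J (bern 0)) := by
  have hu := continues_J_unit_bern_zero.comp_add_shift (d := (-1, 0, 1)) (by decide)
  refine Continues.of_recurrence (F := fun k => (bern (k + 1)).J (bern 0))
    (fun _ => differentiableOn_J _ _) (· + 1) ![(0, 0, 1), (-1, 0, 2)] (by decide)
    (a := fun k p => (-bernoulliFun (k + 2) 0 / (k + 2) * p.2.2) / (p.2.1 + p.2.2 - 1)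
        * unit.J (bern 0) (p + shift (-1, 0, 1))
      + 1 / (p.2.1 + p.2.2 - 1) * (bern (k + 1)).J unit p)
    (fun k => ((Continues.of_differentiableOn ?_).mul hu).add
      ((Continues.of_differentiableOn ?_).mul (Continues.J_swap (continues_J_unit_bern _))))
    (fun k => ![fun p => p.2.2 * (p.1 - 1) / ((k + 2) * (p.2.1 + p.2.2 - 1)),
      fun p => p.2.2 * (p.2.2 + 1) / ((k + 2) * (p.2.1 + p.2.2 - 1))])
    (fun k => Fin.forall_fin_two.2 ⟨?_, ?_⟩) ?_ k
  · refine differentiableOn_div ?_ ?_ fun _ => t_add_u_sub_one_ne_zero <;> fun_prop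
  · refine differentiableOn_div ?_ ?_ fun _ => t_add_u_sub_one_ne_zero <;> fun_prop
  · refine differentiableOn_div ?_ ?_ fun _ hp =>
      mul_ne_zero (natCast_add_two_ne_zero k) (t_add_u_sub_one_ne_zero hp)
    all_goals fun_prop
  · refine differentiableOn_div ?_ ?_ fun _ hp =>
      mul_ne_zero (natCast_add_two_ne_zero k) (t_add_u_sub_one_ne_zero hp)
    all_goals fun_prop
  · rintro k ⟨s, t, u⟩ hp
    have h0 := natCast_add_two_ne_zero k
    have h1 := t_add_u_sub_one_ne_zero (convergenceRegion_subset hp)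
    have h := J_bern_zero (bern (k + 1)) hp
    have h' := J_bern_succ_left (bern 0) k (mem_convergenceRegion_su hp)
    rw [sub_add_cancel, show u + 1 + 1 = u + 2 by ring] at h'
    simp only [Fin.sum_univ_two, Matrix.cons_val_zero, Matrix.cons_val_one,
      shift, Prod.mk_add_mk, Int.cast_zero, Int.cast_one, add_zero, Int.cast_neg, Int.cast_ofNat,
      ← sub_eq_add_neg]
    simp only at h1
    field_simp
    linear_combination (k + 2) * h + u * h'

/-- One integration by parts in `y` produces the translation `(0, 1, 0)`, which leaves `s + u`
unchanged; following it by one in `x` makes all four composite translations raise every sum. -/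
lemma continues_J_bern_succ_bern_succ (k l : ℕ) :
    Continues ((bern (k + 1)).J (bern (l + 1))) := by
  refine Continues.of_recurrence (ι := ℕ × ℕ) (F := fun i => (bern (i.1 + 1)).J (bern (i.2 + 1)))
    (fun _ => differentiableOn_J _ _) (fun i => (i.1 + 1, i.2 + 1))
    ![(1, 1, 0), (0, 1, 1), (1, 0, 1), (0, 0, 2)] (by decide)
    (a := fun i p => -bernoulliFun (i.2 + 2) 0 / (i.2 + 2) * (bern (i.1 + 1)).J unit p
      + (p.2.1 / (i.2 + 2) * (-bernoulliFun (i.1 + 2) 0 / (i.1 + 2))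
          * unit.J (bern (i.2 + 2)) (p + shift (0, 1, 0))
        + p.2.2 / (i.2 + 2) * (-bernoulliFun (i.1 + 2) 0 / (i.1 + 2))
          * unit.J (bern (i.2 + 2)) (p + shift (0, 0, 1))))
    (fun i => ((Continues.of_differentiableOn (differentiableOn_const _)).mul
      (Continues.J_swap (continues_J_unit_bern _))).add
      (((Continues.of_differentiableOn ?_).mul
        ((continues_J_unit_bern (i.2 + 2)).comp_add_shift (by decide))).add
      ((Continues.of_differentiableOn ?_).mul
        ((continues_J_unit_bern (i.2 + 2)).comp_add_shift (by decide)))))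
    (fun i => ![fun p => p.2.1 * p.1 / ((i.1 + 2) * (i.2 + 2)),
      fun p => p.2.1 * p.2.2 / ((i.1 + 2) * (i.2 + 2)),
      fun p => p.2.2 * p.1 / ((i.1 + 2) * (i.2 + 2)),
      fun p => p.2.2 * (p.2.2 + 1) / ((i.1 + 2) * (i.2 + 2))])
    (fun i j => ?_) ?_ (k, l)
  · exact ((differentiableOn_div_const (by fun_prop) _ _).mul_const _)
  · exact ((differentiableOn_div_const (by fun_prop) _ _).mul_const _)
  · fin_cases j <;> simp only [Fin.zero_eta, Fin.mk_one, Fin.reduceFinMk, Matrix.cons_val] <;>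
      exact differentiableOn_div_const (by fun_prop) _ _
  · rintro ⟨k, l⟩ ⟨s, t, u⟩ hp
    have h0 := natCast_add_two_ne_zero k
    have h1 := natCast_add_two_ne_zero l
    have h := J_bern_succ (bern (k + 1)) l hp
    have ht := J_bern_succ_left (bern (l + 2)) k (mem_convergenceRegion_t hp)
    have hu := J_bern_succ_left (bern (l + 2)) k (mem_convergenceRegion_u hp)
    rw [show u + 1 + 1 = u + 2 by ring] at hu
    simp only [Fin.sum_univ_four, Matrix.cons_val,
      shift, Prod.mk_add_mk, Int.cast_zero, Int.cast_one, add_zero, Int.cast_ofNat]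
    field_simp
    linear_combination (k + 2) * h + t * ht + u * hu

lemma continues_J_bern_succ_bern (k l : ℕ) : Continues ((bern (k + 1)).J (bern l)) := by
  cases l with
  | zero => exact continues_J_bern_succ_bern_zero k
  | succ l => exact continues_J_bern_succ_bern_succ k l

lemma continues_mul_J_bern_zero_bern_zero :
    Continues fun p => (p.1 + p.2.1 + p.2.2 - 2) * (bern 0).J (bern 0) p := by
  have h := Continues.J_swap continues_J_unit_bern_zero
  exact (h.add h.comp_swap).congr fun _ hp => (J_bern_zero_bern_zero hp).symm

/-- Euler–Maclaurin in the second variable. The multiplier `q` carries the factor `s + t + u - 2`,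
which only the `bern 0` term may need. -/
lemma continues_mul_J_counting (b : Weight) {q : ℂ × ℂ × ℂ → ℂ} (hq : Differentiable ℂ q)
    (h0 : Continues fun p => q p * b.J (bern 0) p) (hu : Continues (b.J unit))
    (h1 : Continues (b.J (bern 1))) : Continues fun p => q p * b.J counting p := by
  have c1 := (Continues.of_differentiableOn (f := fun p => q p * (1 / 2))
    (Differentiable.differentiableOn (by fun_prop))).mul hu
  have c2 := (Continues.of_differentiableOn (f := fun p => q p * (-p.2.1))
    (Differentiable.differentiableOn (by fun_prop))).mul
    (h1.comp_add_shift (d := (0, 1, 0)) (by decide))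
  have c3 := (Continues.of_differentiableOn (f := fun p => q p * (-p.2.2))
    (Differentiable.differentiableOn (by fun_prop))).mul
    (h1.comp_add_shift (d := (0, 0, 1)) (by decide))
  refine (((h0.add c1).add c2).add c3).congr ?_
  rintro ⟨s, t, u⟩ hp
  simp only [J_counting b hp, shift, Prod.mk_add_mk, Int.cast_zero, Int.cast_one, add_zero]
  ring

lemma continues_J_counting (b : Weight) (h0 : Continues (b.J (bern 0)))
    (hu : Continues (b.J unit)) (h1 : Continues (b.J (bern 1))) : Continues (b.J counting) := by
  simpa using continues_mul_J_counting b (q := fun _ => 1) (by fun_prop) (by simpa using h0) hu h1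

theorem continues_mul_J_counting_counting :
    Continues fun p => (p.1 + p.2.1 + p.2.2 - 2) * counting.J counting p := by
  have hq : Differentiable ℂ fun p : ℂ × ℂ × ℂ => p.1 + p.2.1 + p.2.2 - 2 := by fun_prop
  have h0 := continues_mul_J_counting (bern 0) hq continues_mul_J_bern_zero_bern_zero
    (Continues.J_swap continues_J_unit_bern_zero)
    (Continues.J_swap (continues_J_bern_succ_bern 0 0))
  refine continues_mul_J_counting counting hq (h0.comp_swap.congr ?_)
    (Continues.J_swap (continues_J_counting unit continues_J_unit_bern_zero continues_J_unit_unit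
      (continues_J_unit_bern 1)))
    (Continues.J_swap (continues_J_counting (bern 1) (continues_J_bern_succ_bern 0 0)
      (Continues.J_swap (continues_J_unit_bern 1)) (continues_J_bern_succ_bern 0 1)))
  rintro ⟨s, t, u⟩ -
  simp only [J_swap counting, add_comm s t]

end Weight

/-- The Tornheim double zeta function continues to `partlyRegularSet`, with at most a simple pole
along `s + t + u = 2`. -/
theorem exists_mul_continuation : ∃ G : ℂ × ℂ × ℂ → ℂ, DifferentiableOn ℂ G partlyRegularSet ∧
    ∀ s t u : ℂ, (s, t, u) ∈ convergenceRegion →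
      HasSum (tornheimTerm s t u) (G (s, t, u) / (s + t + u - 2)) := by
  obtain ⟨G, hG, he⟩ := Weight.continues_mul_J_counting_counting
  refine ⟨G, hG, fun s t u hp => ?_⟩
  have hne : s + t + u - 2 ≠ 0 := fun h => by
    have := hp.2.2
    rw [sub_eq_zero.1 h] at this
    simp at this
  rw [he hp, mul_div_cancel_left₀ _ hne]
  exact Weight.hasSum_tornheimTerm hp

/-! ### Uniqueness of the continuation and identification of `T`. -/

lemma countable_intsLeOne : intsLeOne.Countable := by
  refine (countable_range (fun n : ℤ => (n : ℂ))).mono ?_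
  rintro _ ⟨n, _, rfl⟩
  exact mem_range_self n

lemma countable_setOf_affine_mem {Z : Set ℂ} (hZ : Z.Countable) {a b : ℂ} (h : a + b ∉ Z) :
    {z : ℂ | a + z * b ∈ Z}.Countable := by
  rcases eq_or_ne b 0 with rfl | hb
  · refine Set.countable_empty.mono fun z hz => h ?_
    simpa using hz
  · refine hZ.preimage_of_injOn (f := fun z : ℂ => a + z * b) fun x _ y _ hxy => ?_
    simpa [hb] using hxy

lemma regularSet_eq : regularSet = partlyRegularSet ∩ {p | p.1 + p.2.1 + p.2.2 ≠ 2} := by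
  ext p
  simp only [regularSet, partlyRegularSet, mem_inter_iff, mem_ofPred_eq, and_assoc]

lemma isOpen_regularSet : IsOpen regularSet := by
  rw [regularSet_eq]
  exact isOpen_partlyRegularSet.inter (isOpen_ne_fun (by fun_prop) (by fun_prop))

lemma convergenceRegion_subset_regularSet : convergenceRegion ⊆ regularSet := by
  rw [regularSet_eq]
  refine fun p hp => ⟨convergenceRegion_subset hp, fun h => ?_⟩
  have := hp.2.2
  rw [h] at this
  simp at this

lemma isOpen_convergenceRegion : IsOpen convergenceRegion :=
  enlarged_zero ▸ isOpen_enlarged 0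

/-- The identity theorem on `regularSet`: restrict to the complex line through a point of the
region of convergence, which meets the complement in a countable set. -/
theorem eqOn_regularSet {f g : ℂ × ℂ × ℂ → ℂ} (hf : DifferentiableOn ℂ f regularSet)
    (hg : DifferentiableOn ℂ g regularSet) (h : EqOn f g convergenceRegion) :
    EqOn f g regularSet := by
  intro p hp
  have hp₀ : ((2, 2, 0) : ℂ × ℂ × ℂ) ∈ convergenceRegion := by
    refine ⟨?_, ?_, ?_⟩ <;> norm_num
  set p₀ : ℂ × ℂ × ℂ := (2, 2, 0)
  set ℓ : ℂ → ℂ × ℂ × ℂ := fun z => p₀ + z • (p - p₀) with hℓ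
  have hℓd : Differentiable ℂ ℓ := by fun_prop
  have h1 : ℓ 1 = p := by simp [hℓ]
  have h0 : ℓ 0 = p₀ := by simp [hℓ]
  set U := ℓ ⁻¹' regularSet
  have hUo : IsOpen U := isOpen_regularSet.preimage hℓd.continuous
  have hUc : Uᶜ.Countable := by
    have c1 := countable_setOf_affine_mem countable_intsLeOne (a := p₀.2.1 + p₀.2.2)
      (b := (p.2.1 + p.2.2) - (p₀.2.1 + p₀.2.2)) (by rw [add_sub_cancel]; exact hp.1)
    have c2 := countable_setOf_affine_mem countable_intsLeOne (a := p₀.2.2 + p₀.1)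
      (b := (p.2.2 + p.1) - (p₀.2.2 + p₀.1)) (by rw [add_sub_cancel]; exact hp.2.1)
    have c3 := countable_setOf_affine_mem (countable_singleton (2 : ℂ))
      (a := p₀.1 + p₀.2.1 + p₀.2.2)
      (b := (p.1 + p.2.1 + p.2.2) - (p₀.1 + p₀.2.1 + p₀.2.2))
      (by rw [add_sub_cancel]; exact hp.2.2)
    refine ((c1.union c2).union c3).mono fun z hz => ?_
    by_contra hcon
    simp only [mem_union, not_or] at hcon
    refine hz ⟨?_, ?_, ?_⟩
    · convert hcon.1.1 using 1
      simp only [hℓ, Prod.fst_add, Prod.snd_add, Prod.smul_fst, Prod.smul_snd, Prod.fst_sub,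
        Prod.snd_sub, smul_eq_mul, mem_ofPred_eq]
      ring_nf
    · convert hcon.1.2 using 1
      simp only [hℓ, Prod.fst_add, Prod.snd_add, Prod.smul_fst, Prod.smul_snd, Prod.fst_sub,
        Prod.snd_sub, smul_eq_mul, mem_ofPred_eq]
      ring_nf
    · convert hcon.2 using 1
      simp only [hℓ, Prod.fst_add, Prod.snd_add, Prod.smul_fst, Prod.smul_snd, Prod.fst_sub,
        Prod.snd_sub, smul_eq_mul, mem_ofPred_eq, mem_singleton_iff]
      ring_nf
  -- A countable set does not disconnect `ℂ`, whose real dimension exceeds one.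
  have hUconn : IsPreconnected U := by
    have := hUc.isPathConnected_compl_of_one_lt_rank
      (by rw [Complex.rank_real_complex]; exact Cardinal.one_lt_two)
    rw [compl_compl] at this
    exact this.isConnected.isPreconnected
  have hfa : AnalyticOnNhd ℂ (f ∘ ℓ) U :=
    (hf.comp hℓd.differentiableOn (mapsTo_preimage _ _)).analyticOnNhd hUo
  have hga : AnalyticOnNhd ℂ (g ∘ ℓ) U :=
    (hg.comp hℓd.differentiableOn (mapsTo_preimage _ _)).analyticOnNhd hUo
  have hev : f ∘ ℓ =ᶠ[𝓝 0] g ∘ ℓ := by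
    refine eventually_of_mem ((isOpen_convergenceRegion.preimage hℓd.continuous).mem_nhds
      (by rw [mem_preimage, h0]; exact hp₀)) fun z hz => h hz
  have := hfa.eqOn_of_preconnected_of_eventuallyEq hga hUconn
    (by rw [mem_preimage, h0]; exact convergenceRegion_subset_regularSet hp₀) hev
    (show (1 : ℂ) ∈ U by rw [mem_preimage, h1]; exact hp)
  simpa only [Function.comp_apply, h1] using this

lemma holomorphicOn_div {G : ℂ × ℂ × ℂ → ℂ} (hG : DifferentiableOn ℂ G partlyRegularSet) :
    HolomorphicOn (fun s t u => G (s, t, u) / (s + t + u - 2)) regularSet := by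
  refine differentiableOn_div (hG.mono ?_) (by fun_prop) fun p hp => sub_ne_zero.2 hp.2.2
  rw [regularSet_eq]
  exact inter_subset_left

/-- The choice in `T` is meaningful because the explicit quotient is a continuation; the default
value `0` is never seen on `regularSet`. -/
theorem isTornheimContinuation_T : IsTornheimContinuation T := by
  obtain ⟨G, hG, hsum⟩ := exists_mul_continuation
  have hex : ∃ F, IsTornheimContinuation F := ⟨_, holomorphicOn_div hG, hsum⟩
  obtain ⟨hd, hs⟩ := Classical.epsilon_spec hex
  refine ⟨hd.congr fun p hp => if_pos hp, fun s t u hp => ?_⟩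
  rw [T, if_pos (convergenceRegion_subset_regularSet hp)]
  exact hs s t u hp

theorem exists_T_eq_div : ∃ G : ℂ × ℂ × ℂ → ℂ, DifferentiableOn ℂ G partlyRegularSet ∧
    ∀ s t u : ℂ, (s, t, u) ∈ regularSet → T s t u = G (s, t, u) / (s + t + u - 2) := by
  obtain ⟨G, hG, hsum⟩ := exists_mul_continuation
  refine ⟨G, hG, fun s t u hp => ?_⟩
  exact eqOn_regularSet isTornheimContinuation_T.1 (holomorphicOn_div hG)
    (fun p hp => (isTornheimContinuation_T.2 _ _ _ hp).unique (hsum _ _ _ hp)) hp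

/-! ### The exponential factor and the passage to holomorphic identities. -/

lemma differentiable_ex : Differentiable ℂ ex := by
  unfold ex; fun_prop

lemma ex_add (x y : ℂ) : ex (x + y) = ex x * ex y := by
  rw [ex, ex, ex, ← Complex.exp_add]; ring_nf

lemma ex_two_mul (x : ℂ) : ex (2 * x) = ex x ^ 2 := by
  rw [two_mul, ex_add, sq]

lemma ex_two : ex 2 = 1 := by
  rw [ex, Complex.exp_neg, show (Real.pi : ℂ) * Complex.I * 2 = 2 * Real.pi * Complex.I by ring,
    Complex.exp_two_pi_mul_I, inv_one]

/-- The function `ex z - 1` vanishes at `2`. -/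
lemma exists_ex_sub_one_eq : ∃ g : ℂ → ℂ, Differentiable ℂ g ∧ ∀ z, ex z - 1 = (z - 2) * g z := by
  -- The difference quotient at `2`, completed by the derivative there, is entire by removability of
  -- the singularity.
  refine ⟨dslope (fun z => ex z - 1) 2, ?_, fun z => ?_⟩
  · rw [← differentiableOn_univ, Complex.differentiableOn_dslope univ_mem]
    exact (differentiable_ex.sub_const 1).differentiableOn
  · have := sub_smul_dslope (fun z => ex z - 1) 2 z
    rw [smul_eq_mul, ex_two] at this
    rw [this]; ring

lemma holomorphicIdentityOn_regularSet {c : ℂ → ℂ → ℂ → ℂ} {R : ℂ → ℂ → ℂ → ℂ}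
    (hc : Differentiable ℂ fun p : ℂ × ℂ × ℂ => c p.1 p.2.1 p.2.2)
    (h : ∀ s t u, R s t u = c s t u * T s t u) :
    HolomorphicIdentityOn regularSet (fun s t u => c s t u * T s t u) R :=
  ⟨fun s t u => c s t u * T s t u, hc.differentiableOn.mul isTornheimContinuation_T.1,
    fun _ _ _ _ _ => rfl, fun s t u _ _ => h s t u⟩

/-- With `T = G / (z - 2)` and `ex z - 1 = (z - 2) g(z)` at `z = s + t + u`, the common extension is
`c * g * G`, regular across `s + t + u = 2`. -/
lemma holomorphicIdentityOn_partlyRegularSet {c : ℂ → ℂ → ℂ → ℂ} {R : ℂ → ℂ → ℂ → ℂ}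
    (hc : Differentiable ℂ fun p : ℂ × ℂ × ℂ => c p.1 p.2.1 p.2.2)
    (h : ∀ s t u, R s t u = c s t u * (ex (s + t + u) - 1) * T s t u) :
    HolomorphicIdentityOn partlyRegularSet
      (fun s t u => c s t u * (ex (s + t + u) - 1) * T s t u) R := by
  obtain ⟨G, hG, hT⟩ := exists_T_eq_div
  obtain ⟨g, hg, heq⟩ := exists_ex_sub_one_eq
  have hH : ∀ s t u, (s, t, u) ∈ regularSet → c s t u * (ex (s + t + u) - 1) * T s t u =
      c s t u * g (s + t + u) * G (s, t, u) := fun s t u hp => by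
    have hne : s + t + u - 2 ≠ 0 := sub_ne_zero.2 hp.2.2
    rw [hT s t u hp, heq]
    field_simp
  refine ⟨fun s t u => c s t u * g (s + t + u) * G (s, t, u), ?_, fun s t u _ hp => hH s t u hp,
    fun s t u _ hp => (h s t u).trans (hH s t u hp.1)⟩
  exact (hc.mul (hg.comp (by fun_prop))).differentiableOn.mul hG

end TornheimZeta

end

open TornheimZeta
theorem corollary1 :
    -- `T` is the analytic continuation of the Tornheim double series
    IsTornheimContinuation T ∧
    -- (i)
    HolomorphicIdentityOn partlyRegularSet
      (fun s t u => (1 - ex (2 * s)) * (1 - ex (2 * t)) * (ex (s + t + u) - 1) * T s t u)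
      (fun s t u => (ex (2 * (s + t)) - 1) * S₁ s t u + ex s * (1 - ex (2 * t)) * S₁ u s t
        + ex t * (1 - ex (2 * s)) * S₁ t u s) ∧
    -- (ii)
    HolomorphicIdentityOn regularSet
      (fun s t u => (1 - ex (2 * s)) * (1 - ex (2 * t)) * (ex (s + t) - ex u) * T s t u)
      (fun s t u => (ex (2 * (s + t)) - 1) * S₂ s t u + ex t * (1 - ex (2 * s)) * S₁ u s t
        + ex s * (1 - ex (2 * t)) * S₁ t u s) ∧
    -- (iii)
    HolomorphicIdentityOn regularSet
      (fun s t u => 2 * T s t u)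
      (fun s t u => S₃ s t u - S₄ s t u) ∧
    -- (iv)
    HolomorphicIdentityOn regularSet
      (fun s t u => (1 - ex s) * (1 - ex t) * (1 + ex u) * T s t u)
      (fun s t u => (1 + ex u) * (1 + ex (s + t)) * S₃ s t u - S₁ u s t - S₁ t u s) ∧
    -- (v)
    HolomorphicIdentityOn regularSet
      (fun s t u => (1 + ex s) * (1 + ex t) * (1 + ex u) * T s t u)
      (fun s t u => -(1 + ex u) * (1 + ex (s + t)) * S₄ s t u + S₁ u s t + S₁ t u s) ∧
    -- (vi)
    HolomorphicIdentityOn regularSet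
      (fun s t u => (1 - ex s) * (1 - ex t) * (1 + ex u) * T s t u)
      (fun s t u => S₁ s t u + S₂ s t u - (ex s + ex t) * (1 + ex u) * S₃ s t u) ∧
    -- (vii)
    HolomorphicIdentityOn regularSet
      (fun s t u => (1 + ex s) * (1 + ex t) * (1 + ex u) * T s t u)
      (fun s t u => S₁ s t u + S₂ s t u - (ex s + ex t) * (1 + ex u) * S₄ s t u) ∧
    -- (viii)
    HolomorphicIdentityOn regularSet
      (fun s t u => 2 * T s t u)
      (fun s t u => S₄ u s t + S₄ t u s) := by
  have hex := differentiable_ex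
  refine ⟨isTornheimContinuation_T,
    holomorphicIdentityOn_partlyRegularSet
      (c := fun s t _ => (1 - ex (2 * s)) * (1 - ex (2 * t))) ?_ fun s t u => ?_,
    holomorphicIdentityOn_regularSet ?_ fun s t u => ?_,
    holomorphicIdentityOn_regularSet ?_ fun s t u => ?_,
    holomorphicIdentityOn_regularSet ?_ fun s t u => ?_,
    holomorphicIdentityOn_regularSet ?_ fun s t u => ?_,
    holomorphicIdentityOn_regularSet ?_ fun s t u => ?_,
    holomorphicIdentityOn_regularSet ?_ fun s t u => ?_,
    holomorphicIdentityOn_regularSet ?_ fun s t u => ?_⟩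
  -- After expansion every identity is polynomial in `ex s`, `ex t`, `ex u` and linear in the three
  -- cyclic values of `T`. It holds for arbitrary such values, so neither genericity nor any
  -- property of `T` enters.
  all_goals first
    | fun_prop
    | (simp only [S₁, S₂, S₃, S₄, ex_add, ex_two_mul]
       ring)
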